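/- All graphs are finite and simple. For a graph $G$ and a vertex $u$, let $G*u$ (local complementation at $u$) be the graph obtained from $G$ by replacing every edge between two neighbours of $u$ by a non-edge, and vice versa. For an edge $uv$ of $G$, the edge pivot of $uv$ gives the graph $G\wedge uv := G*u*v*u$. A graph $H$ is a pivot-minor of $G$ if $H$ can be obtained from $G$ by a finite sequence of edge pivots and vertex deletions, and $G$ is claw-pivot-minor-free if no pivot-minor of $G$ is isomorphic to the claw $K_{1,3}$. For $X\subseteq V(G)$, the cut-rank $\operatorname{cutrk}_G(X)$ is the rank over the field with two elements of the submatrix of the adjacency matrix of $G$ with rows indexed by $X$ and columns indexed by $V(G)\setminus X$. The width of a linear ordering $(x_1,\dots,x_n)$ of $V(G)$ is $\max_{1\le i\le n}\operatorname{cutrk}_G(\{x_1,\dots,x_i\})$ (and $0$ if $n=0$), and the linear rank-width of $G$ is the minimum width over all linear orderings of $V(G)$. **Theorem.** Every claw-pivot-minor-free graph has linear rank-width at most $59$. -/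

import Mathlib

namespace SimpleGraph

/-- The local complementation `G * u`: adjacency is flipped between any two distinct
neighbours of `u`, and kept for all other pairs. -/
def localComplement {V : Type*} (G : SimpleGraph V) (u : V) : SimpleGraph V where
  Adj x y := x ≠ y ∧ Xor (G.Adj x y) (G.Adj u x ∧ G.Adj u y)
  symm := ⟨fun x y h => ⟨h.1.symm, by
    have h2 := h.2
    rwa [G.adj_comm x y, and_comm (a := G.Adj u x)] at h2⟩⟩
  loopless := ⟨fun _ h => h.1 rfl⟩

/-- The edge pivot `G ∧ uv = G * u * v * u` (used only when `uv` is an edge of `G`). -/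
def pivot {V : Type*} (G : SimpleGraph V) (u v : V) : SimpleGraph V :=
  ((G.localComplement u).localComplement v).localComplement u

/-- `IsPivotMinor G S H`: the graph `H`, whose vertex set is the subset `S` of the vertex set
of `G`, is obtained from `G` by a finite sequence of edge pivots and vertex deletions. -/
inductive IsPivotMinor {V : Type*} (G : SimpleGraph V) :
    (S : Set V) → SimpleGraph S → Prop
  | refl : IsPivotMinor G Set.univ (G.induce Set.univ)
  | pivot {S : Set V} {H : SimpleGraph S} (h : IsPivotMinor G S H) (u v : S)
      (huv : H.Adj u v) : IsPivotMinor G S (H.pivot u v)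
  | deleteVertex {S : Set V} {H : SimpleGraph S} (h : IsPivotMinor G S H) (v : S) :
      IsPivotMinor G (S \ {(v : V)})
        (H.comap (Set.inclusion (Set.sdiff_subset : S \ {(v : V)} ⊆ S)))

/-- `G` is `T`-pivot-minor-free: no pivot-minor of `G` is isomorphic to `T`. -/
def PivotMinorFree {V W : Type*} (G : SimpleGraph V) (T : SimpleGraph W) : Prop :=
  ∀ (S : Set V) (H : SimpleGraph S), G.IsPivotMinor S H → IsEmpty (H ≃g T)

open Classical in
/-- The cut-rank of `X`: the rank over the binary field of the submatrix of the adjacency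
matrix with rows in `X` and columns in the complement of `X`. -/
noncomputable def cutRank {V : Type*} [Fintype V] (G : SimpleGraph V) (X : Set V) : ℕ :=
  ((G.adjMatrix (ZMod 2)).submatrix (fun x : X => (x : V))
    (fun y : (Xᶜ : Set V) => (y : V))).rank

/-- The width of a linear ordering of the vertices: the maximum cut-rank of a nonempty
initial segment (and `0` for the graph with no vertices). -/
noncomputable def orderingWidth {V : Type*} [Fintype V] (G : SimpleGraph V)
    (x : Fin (Fintype.card V) ≃ V) : ℕ :=
  Finset.univ.sup fun i : Fin (Fintype.card V) => G.cutRank {v | ∃ j, j ≤ i ∧ x j = v}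

/-- The linear rank-width: the minimum width over all linear orderings of the vertices. -/
noncomputable def linearRankWidth {V : Type*} [Fintype V] (G : SimpleGraph V) : ℕ :=
  ⨅ x : Fin (Fintype.card V) ≃ V, G.orderingWidth x

/-- The claw, that is, the complete bipartite graph with parts of sizes `1` and `3`. -/
def claw : SimpleGraph (Fin 1 ⊕ Fin 3) := completeBipartiteGraph (Fin 1) (Fin 3)

end SimpleGraph

/-! Pivoting one edge turns the five-vertex path, the bull and the four-spoked wheel into graphs
with an induced claw, so `G` has none of these four as an induced subgraph. Without claw, path and
bull, an induced path on three vertices dominates its component, whence no component has three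
pairwise nonadjacent vertices (`no_independent_triple`). Components can be ordered one after another
at no cost, and complementing raises the width by at most one. It remains to order a triangle-free
graph `H` without induced 2K₂ + K₁, the complement of the wheel.

A shortest odd closed walk in `H` has no chords, and from length nine on it contains 2K₂ + K₁. If
`H` is bipartite, the components of its bipartite complement are chain graphs, which gives width 3.
With a seven-cycle but no five-cycle, `H` is a blow-up of the seven-cycle. With a five-cycle, every
vertex is a clone of a cycle vertex, has one neighbour on the cycle, or is isolated. Adjacency
between these classes is constant or nested; splitting them into 41 letters and choosing one common
key, adjacency depends only on the two letters and on which vertex comes first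
(`FiveFrame.hasOrder`). Then each cut factors through the letters (`HasOrder.of_letters`), so the
width is at most 41 + 1 = 42. -/

namespace SimpleGraph

open Finset Function

variable {V : Type*}

/-! ### Vertex orders and factorizations of cuts -/

/-- The cut matrix of `X` factors through `n`-dimensional space over the binary field. -/
def CutFactors (G : SimpleGraph V) (X : Set V) (n : ℕ) : Prop :=
  ∃ (ι : Type) (_ : Fintype ι) (p q : V → ι → ZMod 2), Fintype.card ι ≤ n ∧
    ∀ x ∈ X, ∀ y ∉ X, (∑ i, p x i * q y i = 1 ∧ G.Adj x y) ∨
      (∑ i, p x i * q y i = 0 ∧ ¬ G.Adj x y)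

/-- `X` is an initial segment for the preorder given by `key`, ties being split arbitrarily. -/
def IsInitial {L : Type*} [LE L] (key : V → L) (X : Set V) : Prop :=
  ∀ x ∈ X, ∀ y ∉ X, key x ≤ key y

/-- Some ordering of the vertices has all its cuts factoring through dimension `n`. -/
def HasOrder (G : SimpleGraph V) (n : ℕ) : Prop :=
  ∃ r : V → ℕ, Injective r ∧ ∀ X, IsInitial r X → G.CutFactors X n

theorem CutFactors.mono {G : SimpleGraph V} {X : Set V} {m n : ℕ} (h : G.CutFactors X m)
    (hmn : m ≤ n) : G.CutFactors X n := by
  obtain ⟨ι, hι, p, q, hc, h⟩ := h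
  exact ⟨ι, hι, p, q, hc.trans hmn, h⟩

theorem HasOrder.mono {G : SimpleGraph V} {m n : ℕ} (h : G.HasOrder m)
    (hmn : m ≤ n) : G.HasOrder n := by
  obtain ⟨r, hr, h⟩ := h
  exact ⟨r, hr, fun X hX => (h X hX).mono hmn⟩

theorem CutFactors.cutRank_le [Fintype V] {G : SimpleGraph V} {X : Set V} {n : ℕ}
    (h : G.CutFactors X n) : G.cutRank X ≤ n := by
  classical
  obtain ⟨ι, hι, p, q, hc, h⟩ := h
  have key : (G.adjMatrix (ZMod 2)).submatrix (fun x : X => (x : V))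
      (fun y : (Xᶜ : Set V) => (y : V)) =
      (Matrix.of fun (x : X) (i : ι) => p x i) *
        (Matrix.of fun (i : ι) (y : (Xᶜ : Set V)) => q y i) := by
    ext x y
    rcases h x x.2 y y.2 with h1 | h1
    · simp [Matrix.mul_apply, adjMatrix_apply, h1]
    · simp [Matrix.mul_apply, adjMatrix_apply, h1]
  unfold cutRank
  rw [key]
  exact (Matrix.rank_mul_le_left _ _).trans ((Matrix.rank_le_card_width _).trans hc)

/-- Every key function on a finite type is refined by an injective numbering. -/
theorem exists_injective_refining [Finite V] {L : Type*} [LinearOrder L] (key : V → L) :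
    ∃ r : V → ℕ, Injective r ∧ ∀ x y, r x ≤ r y → key x ≤ key y := by
  classical
  have := Fintype.ofFinite V
  let e := Fintype.equivFin V
  let k : V → L ×ₗ Fin (Fintype.card V) := fun v => toLex (key v, e v)
  have hk : Injective k := fun x y h => e.injective (congrArg (fun z => (ofLex z).2) h)
  have hmono : ∀ x y, k x < k y → #{w | k w < k x} < #{w | k w < k y} := by
    intro x y h
    refine card_lt_card (Finset.ssubset_iff_subset_ne.2 ⟨fun w hw => ?_, fun he => ?_⟩)
    · simp only [mem_filter, mem_univ, true_and] at hw ⊢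
      exact hw.trans h
    · have : x ∈ ({w | k w < k y} : Finset V) := by simpa using h
      rw [← he] at this
      simp at this
  refine ⟨fun v => #{w | k w < k v}, fun x y h => ?_, fun x y h => ?_⟩
  · by_contra hne
    rcases lt_or_gt_of_ne (fun h => hne (hk h)) with h1 | h1
    · exact absurd h (hmono _ _ h1).ne
    · exact absurd h (hmono _ _ h1).ne'
  · by_contra hlt
    rw [not_le] at hlt
    have h1 : k y < k x := Prod.Lex.toLex_lt_toLex.2 (Or.inl hlt)
    exact absurd (hmono _ _ h1) (not_lt.2 h)

/-- An initial segment for a refinement of `key` is initial for `key`, so ties may be broken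
arbitrarily. -/
theorem HasOrder.of_key [Finite V] {G : SimpleGraph V} {n : ℕ} {L : Type*} [LinearOrder L]
    (key : V → L) (h : ∀ X, IsInitial key X → G.CutFactors X n) : G.HasOrder n := by
  obtain ⟨r, hr, hrk⟩ := exists_injective_refining key
  exact ⟨r, hr, fun X hX => h X fun x hx y hy => hrk _ _ (hX x hx y hy)⟩

theorem HasOrder.linearRankWidth_le [Fintype V] {G : SimpleGraph V} {n : ℕ}
    (h : G.HasOrder n) : G.linearRankWidth ≤ n := by
  classical
  obtain ⟨r, hr, h⟩ := h
  let _ : LinearOrder V := LinearOrder.lift' r hr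
  let e : Fin (Fintype.card V) ≃o V := Fintype.orderIsoFinOfCardEq V rfl
  refine (ciInf_le (OrderBot.bddBelow _) e.toEquiv).trans ?_
  refine Finset.sup_le fun i _ => (h _ ?_).cutRank_le
  rintro x ⟨j, hj, rfl⟩ y hy
  obtain ⟨k, rfl⟩ := e.surjective y
  have : e j ≤ e k := by
    rw [e.le_iff_le]
    by_contra hlt
    exact hy ⟨k, (not_le.1 hlt).le.trans hj, rfl⟩
  exact this

/-- If adjacency is determined by finitely many letters and the order of the keys, then
all cuts factor through the number of letters. -/
theorem HasOrder.of_letters [Finite V] {G : SimpleGraph V} {α : Type} [Fintype α] {L : Type*}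
    [LinearOrder L] (key : V → L) (c : V → α) (T : α → α → Prop)
    (h : ∀ x y, x ≠ y → key x ≤ key y → (G.Adj x y ↔ T (c x) (c y))) :
    G.HasOrder (Fintype.card α) := by
  classical
  -- The coordinates are the letters: the row of `x` is the unit vector of its letter, the column of
  -- `y` lists the letters joined to `y` from before.
  refine HasOrder.of_key key fun X hX => ⟨α, inferInstance, fun x i => if c x = i then 1 else 0,
    fun y i => if T i (c y) then 1 else 0, le_rfl, fun x hx y hy => ?_⟩
  have := h x y (fun e => hy (e ▸ hx)) (hX x hx y hy)
  simp only [ite_mul, one_mul, zero_mul, Finset.sum_ite_eq, mem_univ, if_true]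
  by_cases hT : T (c x) (c y)
  · simp [hT, this]
  · simp [hT, this]

/-- Over the binary field, complementing a cut adds the all-ones matrix; one extra coordinate,
constantly 1, supplies it. -/
theorem HasOrder.of_compl {G : SimpleGraph V} {n : ℕ} (h : Gᶜ.HasOrder n) :
    G.HasOrder (n + 1) := by
  obtain ⟨r, hr, h⟩ := h
  refine ⟨r, hr, fun X hX => ?_⟩
  obtain ⟨ι, hι, p, q, hc, h⟩ := h X hX
  refine ⟨Option ι, inferInstance, fun x i => i.elim 1 (p x), fun x i => i.elim 1 (q x), by simpa,
    fun x hx y hy => ?_⟩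
  have hne : x ≠ y := fun e => hy (e ▸ hx)
  rcases h x hx y hy with ⟨h1, h2⟩ | ⟨h1, h2⟩
  · right
    simp only [Fintype.sum_option, Option.elim_none, Option.elim_some, h1]
    exact ⟨by decide, fun h3 => ((compl_adj _ _ _).1 h2).2 h3⟩
  · left
    simp only [Fintype.sum_option, Option.elim_none, Option.elim_some, h1]
    refine ⟨by decide, ?_⟩
    by_contra h3
    exact h2 ((compl_adj _ _ _).2 ⟨hne, h3⟩)

/-- At most one block of a lexicographic order is split by an initial segment. -/
theorem IsInitial.exists_block {K L : Type*} [Inhabited K] [LinearOrder K] [LinearOrder L]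
    {g : V → K} {key : V → L}
    {X : Set V} (hX : IsInitial (fun v => toLex (g v, key v)) X) :
    ∃ a, ∀ x ∈ X, ∀ y ∉ X, g x = g y → g x = a := by
  by_cases h : ∃ x ∈ X, ∃ y ∉ X, g x = g y
  · obtain ⟨x, hx, y, hy, hxy⟩ := h
    refine ⟨g x, fun x' hx' y' hy' he => le_antisymm ?_ ?_⟩
    · have := Prod.Lex.monotone_fst _ _ (hX x' hx' y hy)
      exact this.trans hxy.ge
    · have := Prod.Lex.monotone_fst _ _ (hX x hx y' hy')
      exact this.trans he.ge
  · push Not at h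
    exact ⟨default, fun x hx y hy he => absurd he (h x hx y hy)⟩

theorem IsInitial.key_le {K L : Type*} [LinearOrder K] [LinearOrder L]
    {g : V → K} {key : V → L} {X : Set V} (hX : IsInitial (fun v => toLex (g v, key v)) X)
    {x y : V} (hx : x ∈ X) (hy : y ∉ X) (h : g x = g y) : key x ≤ key y := by
  have := hX x hx y hy
  rw [Prod.Lex.toLex_le_toLex] at this
  rcases this with h1 | h1
  · exact absurd h h1.ne
  · exact h1.2

/-- Orders of the connected components combine to an order of the graph. -/
theorem HasOrder.of_components [Finite V] {G : SimpleGraph V} {n : ℕ}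
    (h : ∀ c : G.ConnectedComponent, (G.induce c.supp).HasOrder n) : G.HasOrder n := by
  classical
  have := Fintype.ofFinite V
  choose r hr hcut using h
  let e := Fintype.equivFin G.ConnectedComponent
  let g : V → ℕ := fun v => e (G.connectedComponentMk v)
  have hg : ∀ {x y}, g x = g y → G.connectedComponentMk x = G.connectedComponentMk y :=
    fun h => e.injective (Fin.ext h)
  let key : V → ℕ := fun v => r (G.connectedComponentMk v) ⟨v, rfl⟩
  refine HasOrder.of_key (fun v => toLex (g v, key v)) fun X hX => ?_
  obtain ⟨a, ha⟩ := hX.exists_block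
  by_cases hav : ∃ v, g v = a
  swap
  -- If `a` numbers no component, no component is split and the cut matrix is zero.
  · refine ⟨Empty, inferInstance, fun _ _ => 0, fun _ _ => 0, by simp, fun x hx y hy => ?_⟩
    right
    refine ⟨by simp, fun hxy => hav ⟨x, ha x hx y hy ?_⟩⟩
    simp only [g]
    rw [ConnectedComponent.connectedComponentMk_eq_of_adj hxy]
  obtain ⟨v, rfl⟩ := hav
  let c := G.connectedComponentMk v
  have hkey : ∀ w : c.supp, key w = r c w := by
    rintro ⟨w, hw⟩
    have : ∀ d (hd : G.connectedComponentMk w = d),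
        r (G.connectedComponentMk w) ⟨w, rfl⟩ = r d ⟨w, hd⟩ := by
      rintro _ rfl
      rfl
    exact this c hw
  obtain ⟨ι, hι, p, q, hc, hpq⟩ := hcut c (Subtype.val ⁻¹' X) (by
    intro x hx y hy
    rw [← hkey, ← hkey]
    refine hX.key_le hx hy ?_
    have h1 : G.connectedComponentMk x = c := x.2
    have h2 : G.connectedComponentMk y = c := y.2
    simp only [g, h1, h2])
  refine ⟨ι, hι, fun x i => if hx : x ∈ c.supp then p ⟨x, hx⟩ i else 0,
    fun x i => if hx : x ∈ c.supp then q ⟨x, hx⟩ i else 0, hc, fun x hx y hy => ?_⟩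
  by_cases hxy : x ∈ c.supp ∧ y ∈ c.supp
  · obtain ⟨hxc, hyc⟩ := hxy
    have := hpq ⟨x, hxc⟩ hx ⟨y, hyc⟩ hy
    simpa [hxc, hyc] using this
  · right
    constructor
    · refine Finset.sum_eq_zero fun i _ => ?_
      rw [not_and_or] at hxy
      rcases hxy with h1 | h1 <;> simp only [dif_neg h1, zero_mul, mul_zero]
    · intro hadj
      have h1 : G.connectedComponentMk x = G.connectedComponentMk y :=
        ConnectedComponent.connectedComponentMk_eq_of_adj hadj
      have h2 : g x = g v := ha x hx y hy (by simp only [g, h1])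
      exact hxy ⟨hg h2, h1.symm.trans (hg h2)⟩

/-! ### Induced subgraphs excluded by a single pivot -/

theorem IsPivotMinor.comap_inclusion [Finite V] {G : SimpleGraph V} {S T : Set V}
    {H : SimpleGraph S} (h : G.IsPivotMinor S H) (hT : T ⊆ S) :
    G.IsPivotMinor T (H.comap (Set.inclusion hT)) := by
  induction hn : (S \ T).ncard generalizing S with
  | zero =>
    have : S \ T = ∅ := (Set.ncard_eq_zero (Set.toFinite _)).1 hn
    obtain rfl : T = S := hT.antisymm (Set.sdiff_eq_empty.1 this)
    exact h
  | succ n ih =>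
    obtain ⟨v, hvS, hvT⟩ : (S \ T).Nonempty := by
      rw [← Set.ncard_pos (Set.toFinite _)]
      omega
    have hT' : T ⊆ S \ {v} := fun x hx => ⟨hT hx, fun e => hvT (e ▸ hx)⟩
    refine ih (h.deleteVertex ⟨v, hvS⟩) hT' ?_
    have : (S \ {v}) \ T = (S \ T) \ {v} := by
      ext
      simp only [Set.mem_sdiff]
      tauto
    simp only [this]
    rw [Set.ncard_sdiff_singleton_of_mem (show v ∈ S \ T from ⟨hvS, hvT⟩)]
    omega

/-- The graph has no induced claw. -/
def ClawFree (G : SimpleGraph V) : Prop :=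
  ∀ u a b c, a ≠ b → a ≠ c → b ≠ c → G.Adj u a → G.Adj u b → G.Adj u c →
    ¬ G.Adj a b → ¬ G.Adj a c → ¬ G.Adj b c → False

theorem PivotMinorFree.clawFree_of_isPivotMinor [Finite V] {G : SimpleGraph V}
    (hG : G.PivotMinorFree claw) {S : Set V} {H : SimpleGraph S} (h : G.IsPivotMinor S H) :
    H.ClawFree := by
  intro u a b c hab hac hbc ha hb hc nab nac nbc
  let f : Fin 1 ⊕ Fin 3 → S := Sum.elim (fun _ => u) ![a, b, c]
  have hf : ∀ i j, H.Adj (f i) (f j) ↔ claw.Adj i j := by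
    rintro (i | i) (j | j)
    · simp [f, claw]
    · fin_cases j <;> simp [f, claw, *]
    · fin_cases i <;> simp [f, claw, H.adj_comm _ u, *]
    · fin_cases i <;> fin_cases j <;> simp [f, claw, H.adj_comm b a, H.adj_comm c, *]
  have hinj : Injective f := by
    rintro (i | i) (j | j) hij
    · simp [Subsingleton.elim i j]
    · exact absurd hij (fun e => H.loopless.1 (f (.inr j)) (by
        conv_lhs => rw [← e]
        rw [hf]; simp [claw]))
    · exact absurd hij (fun e => H.loopless.1 (f (.inr i)) (by
        conv_rhs => rw [e]
        rw [hf]; simp [claw]))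
    · fin_cases i <;> fin_cases j <;> simp_all [f]
  have hr : Set.range (fun i => (f i : V)) ⊆ S := by
    rintro _ ⟨i, rfl⟩
    exact (f i).2
  refine (hG _ _ (h.comap_inclusion hr)).false (RelIso.symm
    ⟨Equiv.ofInjective (fun i => (f i : V)) (Subtype.val_injective.comp hinj), ?_⟩)
  intro i j
  exact hf i j

theorem ClawFree.of_injective {W : Type*} {G : SimpleGraph V} {H : SimpleGraph W}
    (hH : H.ClawFree) (f : V → W) (hf : Injective f)
    (hadj : ∀ x y, H.Adj (f x) (f y) ↔ G.Adj x y) : G.ClawFree := by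
  intro u a b c hab hac hbc ha hb hc nab nac nbc
  rw [← hadj] at ha hb hc nab nac nbc
  exact hH _ _ _ _ (hf.ne hab) (hf.ne hac) (hf.ne hbc) ha hb hc nab nac nbc

theorem PivotMinorFree.clawFree [Finite V] {G : SimpleGraph V}
    (hG : G.PivotMinorFree claw) : G.ClawFree :=
  (hG.clawFree_of_isPivotMinor .refl).of_injective (fun v => ⟨v, Set.mem_univ v⟩)
    (fun _ _ h => congrArg Subtype.val h) fun _ _ => Iff.rfl

theorem PivotMinorFree.clawFree_pivot [Finite V] {G : SimpleGraph V}
    (hG : G.PivotMinorFree claw) {x y : V} (hxy : G.Adj x y) : (G.pivot x y).ClawFree := by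
  have := hG.clawFree_of_isPivotMinor
    (.pivot .refl ⟨x, Set.mem_univ x⟩ ⟨y, Set.mem_univ y⟩ (by simpa using hxy))
  refine this.of_injective (fun v => ⟨v, Set.mem_univ v⟩)
    (fun _ _ h => congrArg Subtype.val h) fun a b => ?_
  simp only [pivot, localComplement, comap_adj, Embedding.subtype_apply, ne_eq, Subtype.mk.injEq]

/-- No induced path on five vertices. -/
theorem PivotMinorFree.not_path_five [Finite V] {G : SimpleGraph V} (hG : G.PivotMinorFree claw)
    {a b c d e : V} (hab : G.Adj a b) (hbc : G.Adj b c) (hcd : G.Adj c d) (hde : G.Adj d e)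
    (hac : ¬ G.Adj a c) (had : ¬ G.Adj a d) (hae : ¬ G.Adj a e) (hbd : ¬ G.Adj b d)
    (hbe : ¬ G.Adj b e) (hce : ¬ G.Adj c e) : False := by
  have h1 := hab.ne'
  have h2 := hbc.ne'
  have h3 := hcd.ne'
  have h4 := hde.ne'
  have h5 : c ≠ a := by rintro rfl; exact had hcd
  have h6 : d ≠ a := by rintro rfl; exact hac hcd.symm
  have h7 : e ≠ a := by rintro rfl; exact hbe hab.symm
  have h8 : d ≠ b := by rintro rfl; exact had hab
  have h9 : e ≠ b := by rintro rfl; exact hae hab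
  have h10 : e ≠ c := by rintro rfl; exact hbe hbc
  have s0 := hab.symm
  have s1 := hbc.symm
  have s2 := hcd.symm
  have s3 := hde.symm
  have m0 := mt Adj.symm hac
  have m1 := mt Adj.symm had
  have m2 := mt Adj.symm hae
  have m3 := mt Adj.symm hbd
  have m4 := mt Adj.symm hbe
  have m5 := mt Adj.symm hce
  -- Pivoting `bc` joins `a` to `d` and swaps the roles of `b` and `c`, so `d` is the centre of a
  -- claw with leaves `e`, `a`, `b`.
  refine hG.clawFree_pivot hbc d e a b h7 h9 h1.symm ?_ ?_ ?_ ?_ ?_ ?_ <;>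
  simp [pivot, localComplement, Xor, Ne.symm, *]

/-- No induced bull: a triangle `x y z` with pendant vertices `p` at `x` and `q` at `y`. -/
theorem PivotMinorFree.not_bull [Finite V] {G : SimpleGraph V} (hG : G.PivotMinorFree claw)
    {x y z p q : V} (hxy : G.Adj x y) (hxz : G.Adj x z) (hyz : G.Adj y z) (hpx : G.Adj p x)
    (hqy : G.Adj q y) (hpy : ¬ G.Adj p y) (hpz : ¬ G.Adj p z) (hqx : ¬ G.Adj q x)
    (hqz : ¬ G.Adj q z) (hpq : ¬ G.Adj p q) : False := by
  have h1 := hxy.ne'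
  have h2 := hxz.ne'
  have h3 := hyz.ne'
  have h4 := hpx.ne'
  have h5 := hqy.ne'
  have h6 : p ≠ y := by rintro rfl; exact hpq hqy.symm
  have h7 : p ≠ z := by rintro rfl; exact hpy hyz.symm
  have h8 : q ≠ x := by rintro rfl; exact hpq hpx
  have h9 : q ≠ z := by rintro rfl; exact hqx hxz.symm
  have h10 : p ≠ q := by rintro rfl; exact hpy hqy
  have s0 := hxy.symm
  have s1 := hxz.symm
  have s2 := hyz.symm
  have s3 := hpx.symm
  have s4 := hqy.symm
  have m0 := mt Adj.symm hpy
  have m1 := mt Adj.symm hpz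
  have m2 := mt Adj.symm hqx
  have m3 := mt Adj.symm hqz
  have m4 := mt Adj.symm hpq
  -- Pivoting `xz` joins `p` to `y` and moves the edge `px` to `pz`: a claw at `y`.
  refine hG.clawFree_pivot hxz y q p x h10.symm h8 h4.symm ?_ ?_ ?_ ?_ ?_ ?_ <;>
  simp [pivot, localComplement, Xor, Ne.symm, *]

/-- No induced wheel with hub `h` and rim `a b c d`. -/
theorem PivotMinorFree.not_wheel_four [Finite V] {G : SimpleGraph V} (hG : G.PivotMinorFree claw)
    {h a b c d : V} (ha : G.Adj h a) (hb : G.Adj h b) (hc : G.Adj h c) (hd : G.Adj h d)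
    (hab : G.Adj a b) (hbc : G.Adj b c) (hcd : G.Adj c d) (hda : G.Adj d a)
    (hac : ¬ G.Adj a c) (hbd : ¬ G.Adj b d) (nac : a ≠ c) (nbd : b ≠ d) : False := by
  have h1 := ha.ne'
  have h2 := hb.ne'
  have h3 := hc.ne'
  have h4 := hd.ne'
  have h5 := hab.ne'
  have h6 := hbc.ne'
  have h7 := hcd.ne'
  have h8 := hda.ne'
  have s0 := ha.symm
  have s1 := hb.symm
  have s2 := hc.symm
  have s3 := hd.symm
  have s4 := hab.symm
  have s5 := hbc.symm
  have s6 := hcd.symm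
  have s7 := hda.symm
  have m0 := mt Adj.symm hac
  have m1 := mt Adj.symm hbd
  -- Pivoting `ha` deletes `cb` and `cd` and joins `a` to `c`: a claw at `a`.
  refine hG.clawFree_pivot ha a b d c nbd h6.symm h7 ?_ ?_ ?_ ?_ ?_ ?_ <;>
  simp [pivot, localComplement, Xor, Ne.symm, *]

/-! ### Independent triples in a component -/

theorem Reachable.mem_of_closed {G : SimpleGraph V} {S : Set V}
    (hS : ∀ x ∈ S, ∀ y, G.Adj x y → y ∈ S) {a b : V} (h : G.Reachable a b) (ha : a ∈ S) :
    b ∈ S := by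
  obtain ⟨w⟩ := h
  induction w with
  | nil => exact ha
  | cons hadj _ ih => exact ih (hS _ ha _ hadj)

/-- The closed neighbourhood of an induced path on three vertices contains everything
reachable from it. -/
theorem PivotMinorFree.dominating_path [Finite V] {G : SimpleGraph V} (hG : G.PivotMinorFree claw)
    {a m b c : V} (ham : G.Adj a m) (hmb : G.Adj m b) (hab : ¬ G.Adj a b) (nab : a ≠ b)
    (hc : G.Reachable a c) : (c = a ∨ c = m ∨ c = b) ∨ G.Adj c a ∨ G.Adj c m ∨ G.Adj c b := by
  refine hc.mem_of_closed (S := {c | (c = a ∨ c = m ∨ c = b) ∨ G.Adj c a ∨ G.Adj c m ∨ G.Adj c b})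
    ?_ (by simp)
  intro y hy z hyz
  by_contra hz
  simp only [Set.mem_ofPred_eq, not_or] at hz hy
  obtain ⟨⟨za, zm, zb⟩, hza, hzm, hzb⟩ := hz
  have hy' : y ≠ a ∧ y ≠ m ∧ y ≠ b :=
    ⟨by rintro rfl; exact hza hyz.symm, by rintro rfl; exact hzm hyz.symm,
      by rintro rfl; exact hzb hyz.symm⟩
  obtain ⟨ya, ym, yb⟩ := hy'
  have haz := fun h : G.Adj a z => hza h.symm
  have hmz := fun h : G.Adj m z => hzm h.symm
  have hbz := fun h : G.Adj b z => hzb h.symm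
  have hba := fun h : G.Adj b a => hab h.symm
  by_cases h1 : G.Adj y a <;> by_cases h2 : G.Adj y m <;> by_cases h3 : G.Adj y b
  · exact hG.clawFree y a b z nab (Ne.symm za) (Ne.symm zb) h1 h3 hyz hab haz hbz
  · exact hG.not_bull h2 h1 ham.symm hyz.symm hmb.symm hzm hza (fun h => h3 h.symm) hba hzb
  · exact hG.clawFree y a b z nab (Ne.symm za) (Ne.symm zb) h1 h3 hyz hab haz hbz
  · exact hG.not_path_five hyz.symm h1 ham hmb hza hzm hzb h2 h3 hab
  · exact hG.not_bull h2 h3 hmb hyz.symm ham hzm hzb (fun h => h1 h.symm) hab hza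
  · exact hG.clawFree m a b y nab ya.symm yb.symm ham.symm hmb h2.symm hab (fun h => h1 h.symm)
      (fun h => h3 h.symm)
  · exact hG.not_path_five hyz.symm h3 hmb.symm ham.symm hzb hzm hza h2 h1 hba
  · tauto

/-- The path `a m b` dominates `c`, which can only be attached at `m`; that makes a claw. -/
theorem PivotMinorFree.no_common_neighbor [Finite V] {G : SimpleGraph V}
    (hG : G.PivotMinorFree claw) {a b c m : V} (nab : a ≠ b) (nac : a ≠ c) (nbc : b ≠ c)
    (hab : ¬ G.Adj a b) (hac : ¬ G.Adj a c) (hbc : ¬ G.Adj b c) (h : G.Reachable a c)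
    (ham : G.Adj a m) (hbm : G.Adj b m) : False := by
  rcases hG.dominating_path ham hbm.symm hab nab h with (h | h | h) | h | h | h
  · exact nac h.symm
  · exact hac (h ▸ ham)
  · exact nbc h.symm
  · exact hac h.symm
  · exact hG.clawFree m a b c nab nac nbc ham.symm hbm.symm h.symm hab hac hbc
  · exact hbc h.symm

/-- Connected graphs without claw pivot-minor have no three independent vertices. -/
theorem PivotMinorFree.no_independent_triple [Finite V] {G : SimpleGraph V}
    (hG : G.PivotMinorFree claw) {a b c : V} (nab : a ≠ b) (nac : a ≠ c) (nbc : b ≠ c)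
    (hab : ¬ G.Adj a b) (hac : ¬ G.Adj a c) (hbc : ¬ G.Adj b c) (hb : G.Reachable a b)
    (hc : G.Reachable a c) : False := by
  have hba := fun h : G.Adj b a => hab h.symm
  have hca := fun h : G.Adj c a => hac h.symm
  have hcb := fun h : G.Adj c b => hbc h.symm
  obtain ⟨x, y, hax, hxy, hay, nay⟩ : ∃ x y, G.Adj a x ∧ G.Adj x y ∧ ¬ G.Adj a y ∧ a ≠ y := by
    by_contra hno
    push Not at hno
    have := hb.mem_of_closed (S := {y | y = a ∨ G.Adj a y}) (by
      rintro x (rfl | hx) y hxy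
      · exact Or.inr hxy
      · by_contra h
        simp only [Set.mem_ofPred_eq, not_or] at h
        exact h.1 (hno x y hx hxy h.2).symm) (Or.inl rfl)
    rcases this with h | h
    · exact nab h.symm
    · exact hab h
  have hbx : ¬ G.Adj b x := fun h => hG.no_common_neighbor nab nac nbc hab hac hbc hc hax h
  have hcx : ¬ G.Adj c x := fun h => hG.no_common_neighbor nac nab nbc.symm hac hab hcb hb hax h
  -- The induced path `a x y` dominates `b` and `c`. Both miss `a` and `x`, so `y` becomes a
  -- forbidden common neighbour.
  have key : ∀ {d}, a ≠ d → ¬ G.Adj a d → ¬ G.Adj d x → G.Reachable a d → G.Adj d y := by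
    intro d nad had hdx hd
    rcases hG.dominating_path hax hxy hay nay hd with (h | h | h) | h | h | h
    · exact absurd h.symm nad
    · exact absurd (h ▸ hax) had
    · exact absurd (h ▸ hxy.symm) hdx
    · exact absurd h.symm had
    · exact absurd h hdx
    · exact h
  exact hG.no_common_neighbor nbc nab.symm nac.symm hbc hba hca hb.symm
    (key nab hab hbx hb) (key nac hac hcx hc)

/-! ### The complementary problem: bipartite graphs -/

/-- No triangles. -/
def TriangleFree (H : SimpleGraph V) : Prop :=
  ∀ {a b c}, H.Adj a b → H.Adj b c → H.Adj a c → False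

/-- No induced copy of two disjoint edges plus an isolated vertex, the complement of the wheel
with four spokes. -/
def CoWheelFree (H : SimpleGraph V) : Prop :=
  ∀ {a b c d e}, H.Adj a b → H.Adj c d → ¬ H.Adj a c → ¬ H.Adj a d → ¬ H.Adj b c → ¬ H.Adj b d →
    ¬ H.Adj e a → ¬ H.Adj e b → ¬ H.Adj e c → ¬ H.Adj e d → False

/-- The bipartite complement with respect to a 2-colouring. -/
def bipCompl (H : SimpleGraph V) (col : V → Bool) : SimpleGraph V where
  Adj x y := col x ≠ col y ∧ ¬ H.Adj x y
  symm := ⟨fun _ _ h => ⟨h.1.symm, fun h' => h.2 h'.symm⟩⟩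
  loopless := ⟨fun _ h => h.1 rfl⟩

section Bipartite

variable {H : SimpleGraph V} {col : V → Bool}

/-- A common neighbour `z` of `p` and `p'` in the bipartite complement would form a co-wheel of `H`
with the edges `pq'` and `p'q`. But every vertex reachable from `p` shares a neighbour with
whichever of `p`, `q` has its colour. -/
theorem CoWheelFree.bipCompl_chain (hW : H.CoWheelFree)
    (hcol : ∀ x y, H.Adj x y → col x ≠ col y) {p q p' q' : V}
    (h1 : (H.bipCompl col).Adj p q) (h2 : (H.bipCompl col).Adj p' q') (hpp : col p = col p')
    (n1 : ¬ (H.bipCompl col).Adj p q') (n2 : ¬ (H.bipCompl col).Adj p' q) :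
    ¬ (H.bipCompl col).Reachable p p' := by
  have e1 : ∀ {x y z}, (H.bipCompl col).Adj x y → (H.bipCompl col).Adj y z → col x = col z := by
    intro x y z hxy hyz
    have := hxy.1; have := hyz.1
    revert this; revert this
    cases col x <;> cases col y <;> cases col z <;> simp
  have hadj : ∀ {x y}, ¬ (H.bipCompl col).Adj x y → col x ≠ col y → H.Adj x y := by
    intro x y h hne
    by_contra h'
    exact h ⟨hne, h'⟩
  have hsame : ∀ {x y}, col x = col y → ¬ H.Adj x y := fun h h' => hcol _ _ h' h
  -- two disjoint edges of the bipartite complement have no common neighbour of an end of each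
  have key : ∀ {x y x' y' z}, (H.bipCompl col).Adj x y → (H.bipCompl col).Adj x' y' →
      col x = col x' → ¬ (H.bipCompl col).Adj x y' → ¬ (H.bipCompl col).Adj x' y →
      (H.bipCompl col).Adj x z → (H.bipCompl col).Adj z x' → False := by
    intro x y x' y' z hxy hxy' hxx m1 m2 hz hz'
    have cy : col y = col y' := by
      have := hxy.1; have := hxy'.1
      revert this; revert this; revert hxx
      cases col x <;> cases col x' <;> cases col y <;> cases col y' <;> simp
    refine hW (a := x) (b := y') (c := x') (d := y) (e := z) (hadj m1 ?_) (hadj m2 ?_) (hsame hxx)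
      hxy.2 (fun h => hxy'.2 h.symm) (hsame cy.symm) (fun h => hz.2 h.symm) (hsame ?_) hz'.2
      (hsame ?_)
    · rw [hxx]; exact hxy'.1
    · rw [← hxx]; exact hxy.1
    · exact (e1 hz.symm hxy).trans cy
    · exact e1 hz.symm hxy
  intro hreach
  have cpq := h1.1
  have := hreach.mem_of_closed (S := {x | (col x = col p ∧ ∃ z, (H.bipCompl col).Adj x z ∧
    (H.bipCompl col).Adj z p) ∨ (col x = col q ∧ ∃ z, (H.bipCompl col).Adj x z ∧
    (H.bipCompl col).Adj z q)}) ?_ (Or.inl ⟨rfl, q, h1, h1.symm⟩)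
  · rcases this with ⟨-, z, hz, hz'⟩ | ⟨h, -⟩
    · exact key h1 h2 hpp n1 n2 hz'.symm hz.symm
    · exact cpq (hpp.trans h)
  · rintro x (⟨cx, z, hz, hz'⟩ | ⟨cx, z, hz, hz'⟩) y hxy
    · have cy : col y = col q := by
        have := hxy.1
        revert this; revert cx; revert cpq
        cases col x <;> cases col y <;> cases col p <;> cases col q <;> simp
      refine Or.inr ⟨cy, ?_⟩
      by_cases a1 : (H.bipCompl col).Adj x q
      · exact ⟨x, hxy.symm, a1⟩
      by_cases a2 : (H.bipCompl col).Adj y p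
      · exact ⟨p, a2, h1⟩
      exact (key h1 hxy cx.symm (fun h => a2 h.symm) a1 hz'.symm hz.symm).elim
    · have cy : col y = col p := by
        have := hxy.1
        revert this; revert cx; revert cpq
        cases col x <;> cases col y <;> cases col p <;> cases col q <;> simp
      refine Or.inl ⟨cy, ?_⟩
      by_cases a1 : (H.bipCompl col).Adj x p
      · exact ⟨x, hxy.symm, a1⟩
      by_cases a2 : (H.bipCompl col).Adj y q
      · exact ⟨q, a2, h1.symm⟩
      exact (key h1.symm hxy cx.symm (fun h => a2 h.symm) a1 hz'.symm hz.symm).elim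

/-- A bipartite graph without co-wheel: its bipartite complement is a disjoint union of chain
graphs, which gives an order of width at most three. -/
theorem CoWheelFree.hasOrder_of_bipartite [Finite V] (hW : H.CoWheelFree)
    (hcol : ∀ x y, H.Adj x y → col x ≠ col y) : H.HasOrder 3 := by
  classical
  have := Fintype.ofFinite V
  let J := H.bipCompl col
  let e := Fintype.equivFin J.ConnectedComponent
  let g : V → ℕ := fun v => e (J.connectedComponentMk v)
  have hg : ∀ {x y}, g x = g y ↔ J.Reachable x y := by
    intro x y
    rw [← ConnectedComponent.eq]
    exact ⟨fun h => e.injective (Fin.ext h), fun h => by simp only [g, h]⟩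
  let d : V → ℕ := fun v => #{w | J.Adj v w}
  -- Chain order in each component of `J`: `true` vertices are sorted by degree, and a `false`
  -- vertex goes just above its non-neighbours. The parity breaks ties.
  let key : V → ℕ := fun v => if col v then 2 * d v else
    2 * ({p | col p ∧ J.Reachable p v ∧ ¬ J.Adj p v} : Finset V).sup d + 1
  have hkey : ∀ p q, col p = true → col q = false → J.Reachable p q →
      (J.Adj p q → key q < key p) ∧ (¬ J.Adj p q → key p < key q) := by
    intro p q hp hq hr
    simp only [key, hp, hq, if_true, Bool.false_eq_true, if_false]
    constructor
    · intro hpq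
      have : ({p | col p ∧ J.Reachable p q ∧ ¬ J.Adj p q} : Finset V).sup d < d p := by
        rw [Finset.sup_lt_iff]
        · intro p' hp'
          simp only [mem_filter, mem_univ, true_and] at hp'
          obtain ⟨cp', hr', hn⟩ := hp'
          refine card_lt_card (Finset.ssubset_iff_subset_ne.2 ⟨fun w hw => ?_, fun he => ?_⟩)
          · simp only [mem_filter, mem_univ, true_and] at hw ⊢
            by_contra hpw
            exact hW.bipCompl_chain hcol hpq hw (hp.trans cp'.symm) hpw hn (hr.trans hr'.symm)
          · have : q ∈ ({w | J.Adj p w} : Finset V) := by simpa using hpq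
            rw [← he] at this
            simp only [mem_filter, mem_univ, true_and] at this
            exact hn this
        · simp only [bot_eq_zero, d, card_pos]
          exact ⟨q, by simpa using hpq⟩
      omega
    · intro hpq
      have : d p ≤ ({p | col p ∧ J.Reachable p q ∧ ¬ J.Adj p q} : Finset V).sup d :=
        Finset.le_sup (f := d) (by simp [hp, hr, hpq])
      omega
  refine HasOrder.of_key (fun v => toLex (g v, key v)) fun X hX => ?_
  obtain ⟨a, ha⟩ := hX.exists_block
  -- Two coordinates produce the complete bipartite graph between the colours. The third cancels it
  -- from `false` to `true` inside the split component, where all such pairs across the cut are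
  -- adjacent in `J`.
  refine ⟨Fin 3, inferInstance,
    fun x => ![if col x then 1 else 0, if col x then 0 else 1, if ¬ col x ∧ g x = a then 1 else 0],
    fun x => ![if col x then 0 else 1, if col x then 1 else 0, if col x ∧ g x = a then 1 else 0],
    by simp, fun x hx y hy => ?_⟩
  have hJ : ∀ {x y}, col x ≠ col y → (H.Adj x y ↔ ¬ J.Adj x y) := by
    intro x y h
    simp [J, bipCompl, h]
  rcases hcx : col x with _ | _ <;> rcases hcy : col y with _ | _
  · right
    exact ⟨by simp [Fin.sum_univ_three, hcx, hcy], fun h => hcol _ _ h (hcx.trans hcy.symm)⟩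
  · rw [hJ (by simp [hcx, hcy])]
    by_cases hgy : g x = g y
    · right
      have hxa := ha x hx y hy hgy
      refine ⟨by simp [Fin.sum_univ_three, hcx, hcy, ← hgy, hxa]; decide, fun hadj => ?_⟩
      exact absurd ((hkey y x hcy hcx (hg.1 hgy).symm).2 fun h => hadj h.symm)
        (not_lt.2 (hX.key_le hx hy hgy))
    · left
      refine ⟨?_, fun hadj => hgy (hg.2 hadj.reachable)⟩
      by_cases h1 : g x = a
      · have h2 : g y ≠ a := fun h => hgy (h1.trans h.symm)
        simp [Fin.sum_univ_three, hcx, hcy, h1, h2]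
      · simp [Fin.sum_univ_three, hcx, hcy, h1]
  · rw [hJ (by simp [hcx, hcy])]
    left
    refine ⟨by simp [Fin.sum_univ_three, hcx, hcy], fun hadj => ?_⟩
    have hr : J.Reachable x y := hadj.reachable
    exact absurd ((hkey x y hcx hcy hr).1 hadj) (not_lt.2 (hX.key_le hx hy (hg.2 hr)))
  · right
    exact ⟨by simp [Fin.sum_univ_three, hcx, hcy], fun h => hcol _ _ h (hcx.trans hcy.symm)⟩

end Bipartite

/-! ### Odd cycles and the blow-up of the seven-cycle -/

/-- A closed walk of length five, presented by its vertices. -/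
def HasFiveCycle (H : SimpleGraph V) : Prop :=
  ∃ a b c d e, H.Adj a b ∧ H.Adj b c ∧ H.Adj c d ∧ H.Adj d e ∧ H.Adj e a

/-- A non-bipartite graph without triangle and co-wheel has a closed walk of length five
or seven. -/
theorem CoWheelFree.bipartite_or_cycle {H : SimpleGraph V} (hW : H.CoWheelFree)
    (hT : H.TriangleFree) : H.Colorable 2 ∨ H.HasFiveCycle ∨
      ∃ v : ZMod 7 → V, ∀ i, H.Adj (v i) (v (i + 1)) := by
  classical
  by_cases hcol : H.Colorable 2
  · exact Or.inl hcol
  right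
  rw [two_colorable_iff_forall_loop_even] at hcol
  push Not at hcol
  have hex : ∃ n, ∃ u, ∃ w : H.Walk u u, Odd n ∧ w.length = n := by
    obtain ⟨u, w, hw⟩ := hcol
    exact ⟨w.length, u, w, Nat.not_even_iff_odd.1 hw, rfl⟩
  obtain ⟨u, w, hodd, hlen⟩ := Nat.find_spec hex
  have hmin : ∀ {x} (w' : H.Walk x x), Odd w'.length → Nat.find hex ≤ w'.length :=
    fun {x} w' h => Nat.find_min' hex ⟨x, w', h, rfl⟩
  generalize Nat.find hex = n at hodd hlen hmin
  have hstep : ∀ i, i < n → H.Adj (w.getVert i) (w.getVert (i + 1)) :=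
    fun i hi => w.adj_getVert_succ (hlen ▸ hi)
  have hend : w.getVert n = w.getVert 0 := by
    rw [← hlen, w.getVert_length, w.getVert_zero]
  have hwalk : ∀ i j, i ≤ j → j ≤ n →
      ∃ q : H.Walk (w.getVert i) (w.getVert j), q.length = j - i := by
    intro i j h1 h2
    refine ⟨((w.drop i).take (j - i)).copy rfl ?_, ?_⟩
    · rw [Walk.drop_getVert, Nat.add_sub_cancel' h1]
    · rw [Walk.length_copy, Walk.take_length, Walk.drop_length]
      omega
  have hchord : ∀ i j, i + 2 ≤ j → j + 2 ≤ n + i → j ≤ n →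
      ¬ H.Adj (w.getVert i) (w.getVert j) := by
    intro i j h1 h2 h3 hadj
    obtain ⟨q, hq⟩ := hwalk i j (by omega) h3
    obtain ⟨q₁, hq₁⟩ := hwalk 0 i (by omega) (by omega)
    obtain ⟨q₂, hq₂⟩ := hwalk j n (by omega) le_rfl
    -- The chord closes both arcs. The two lengths add up to `n + 2`, so one is odd, and both are
    -- below `n`.
    have hA := hmin (q.cons hadj.symm)
    have hB := hmin (q₁.append ((q₂.copy rfl hend).cons hadj))
    simp only [Walk.length_cons, Walk.length_append, Walk.length_copy, hq, hq₁, hq₂,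
      Nat.odd_iff] at hA hB hodd
    omega
  have hsucc : ∀ m, n = m → ∀ k < m,
      H.Adj (w.getVert k) (w.getVert (if k + 1 = m then 0 else k + 1)) := by
    rintro _ rfl k hk
    have := hstep k hk
    split_ifs with h
    · rwa [h, hend] at this
    · exact this
  have hcases : n = 1 ∨ n = 3 ∨ n = 5 ∨ n = 7 ∨ 9 ≤ n := by
    rw [Nat.odd_iff] at hodd
    omega
  rcases hcases with h | h | h | h | h
  · exact absurd rfl (hsucc _ h 0 (by norm_num)).ne
  · exact (hT (hsucc _ h 0 (by norm_num)) (hsucc _ h 1 (by norm_num))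
      (hsucc _ h 2 (by norm_num)).symm).elim
  · left
    exact ⟨_, _, _, _, _, hsucc _ h 0 (by norm_num), hsucc _ h 1 (by norm_num),
      hsucc _ h 2 (by norm_num), hsucc _ h 3 (by norm_num), hsucc _ h 4 (by norm_num)⟩
  · right
    refine ⟨fun i => w.getVert i.val, fun i => ?_⟩
    have h2 : (i + 1).val = if i.val + 1 = 7 then 0 else i.val + 1 := by
      revert i
      decide
    have h1 := hsucc _ h i.val (ZMod.val_lt i)
    rwa [← h2] at h1
  · refine (hW (hstep 0 (by omega)) (hstep 3 (by omega)) (hchord 0 3 ?_ ?_ ?_) (hchord 0 4 ?_ ?_ ?_)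
      (hchord 1 3 ?_ ?_ ?_) (hchord 1 4 ?_ ?_ ?_) (fun h => hchord 0 6 ?_ ?_ ?_ h.symm)
      (fun h => hchord 1 6 ?_ ?_ ?_ h.symm) (fun h => hchord 3 6 ?_ ?_ ?_ h.symm)
      (fun h => hchord 4 6 ?_ ?_ ?_ h.symm)).elim <;> omega

/-- A graph with a closed walk of length seven, but without triangle, closed walk of length five
and co-wheel, is a blow-up of the cycle of length seven. -/
theorem CoWheelFree.hasOrder_of_seven_cycle [Finite V] {H : SimpleGraph V} (hW : H.CoWheelFree)
    (hT : H.TriangleFree) (h5 : ¬ H.HasFiveCycle) {v : ZMod 7 → V}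
    (hv : ∀ i, H.Adj (v i) (v (i + 1))) : H.HasOrder 7 := by
  have hadj : ∀ i j, j = i + 1 ∨ i = j + 1 → H.Adj (v i) (v j) := by
    rintro i j (rfl | rfl)
    · exact hv i
    · exact (hv j).symm
  have hd2 : ∀ x i j, j = i + 1 ∨ i = j + 1 → H.Adj x (v i) → H.Adj x (v j) → False :=
    fun x i j h h1 h2 => hT h1 (hadj i j h) h2
  have hd3 : ∀ x i, H.Adj x (v i) → H.Adj x (v (i + 3)) → False := by
    intro x i h1 h2
    exact h5 ⟨_, _, _, _, _, h1, hadj i (i + 1) (by simp), hadj (i + 1) (i + 2) (by left; ring),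
      hadj (i + 2) (i + 3) (by left; ring), h2.symm⟩
  have hn2 : ∀ i, ¬ H.Adj (v i) (v (i + 2)) := fun i h =>
    hd2 _ (i + 1) (i + 2) (by left; ring) (hv i) h
  have hn3 : ∀ i, ¬ H.Adj (v i) (v (i + 3)) := by
    intro i h
    exact h5 ⟨_, _, _, _, _, h, hadj (i + 3) (i + 4) (by left; ring),
      hadj (i + 4) (i + 5) (by left; ring), hadj (i + 5) (i + 6) (by left; ring),
      hadj (i + 6) i (by left; ring_nf; reduce_mod_char)⟩
  have hn : ∀ i j, ¬ (j = i + 1 ∨ i = j + 1) → ¬ H.Adj (v i) (v j) := by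
    intro i j h
    have : j = i ∨ j = i + 2 ∨ j = i + 3 ∨ i = j + 2 ∨ i = j + 3 := by
      revert i j
      decide
    rcases this with rfl | rfl | rfl | rfl | rfl
    · exact H.loopless.1 _
    · exact hn2 i
    · exact hn3 i
    · exact fun h => hn2 j h.symm
    · exact fun h => hn3 j h.symm
  have hpos : ∀ x, ∃ j, H.Adj x (v (j - 1)) ∧ H.Adj x (v (j + 1)) := by
    intro x
    have hhit : ∀ i, H.Adj x (v i) ∨ H.Adj x (v (i + 1)) ∨ H.Adj x (v (i + 3)) ∨
        H.Adj x (v (i + 4)) := by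
      intro i
      by_contra h
      simp only [not_or] at h
      obtain ⟨a1, a2, a3, a4⟩ := h
      refine hW (hv i) (hadj (i + 3) (i + 4) (by left; ring)) (hn _ _ ?_) (hn _ _ ?_) (hn _ _ ?_)
        (hn _ _ ?_) a1 a2 a3 a4 <;> clear a1 a2 a3 a4 <;> revert i <;> decide
    obtain ⟨k, hk⟩ : ∃ k, H.Adj x (v k) := by
      rcases hhit 0 with h | h | h | h <;> exact ⟨_, h⟩
    -- Of the candidates `k + 1`, `k + 2`, `k + 4`, `k + 5`, the first gives a triangle and the
    -- third a five-cycle; the others are at distance two from `k`.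
    have h1 := hhit (k + 1)
    rcases h1 with h | h | h | h
    · exact (hd2 x k (k + 1) (by simp) hk h).elim
    · exact ⟨k + 1, by simpa using hk, h⟩
    · exact (hd3 x (k + 4) (by convert h using 2; ring)
        (by convert hk using 2; ring_nf; reduce_mod_char)).elim
    · exact ⟨k - 1, by convert h using 2; ring_nf; reduce_mod_char, by simpa using hk⟩
  choose c hc1 hc2 using hpos
  have key : ∀ x y, c x = c y → ¬ H.Adj x y := by
    intro x y h hxy
    exact hT hxy (hc1 y) (h ▸ hc1 x)
  have key2 : ∀ x y, c y = c x + 2 → ¬ H.Adj x y := by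
    intro x y h hxy
    have := hc1 y
    rw [h, show c x + 2 - 1 = c x + 1 by ring] at this
    exact hT hxy this (hc2 x)
  have key3 : ∀ x y, c y = c x + 3 → ¬ H.Adj x y := by
    intro x y h hxy
    have := hc2 y
    rw [h, show c x + 3 + 1 = c x + 4 by ring] at this
    have h' := hc1 x
    rw [show c x - 1 = c x + 6 by ring_nf; reduce_mod_char] at h'
    exact h5 ⟨_, _, _, _, _, hxy, this, hadj (c x + 4) (c x + 5) (by left; ring),
      hadj (c x + 5) (c x + 6) (by left; ring), h'.symm⟩
  have key1 : ∀ x y, c y = c x + 1 → H.Adj x y := by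
    intro x y h
    by_contra hxy
    have hx := hc1 x
    have hx' := hc2 x
    have hy := hc2 y
    rw [h, show c x + 1 + 1 = c x + 2 by ring] at hy
    have hy' := hc1 y
    rw [h, add_sub_cancel_right] at hy'
    generalize c x = k at *
    -- The co-wheel has the edges `x v (k - 1)` and `y v (k + 2)` and the isolated vertex `v (k +
    -- 4)`.
    refine hW hx hy hxy (fun h' => hd2 x (k + 1) (k + 2) (by left; ring) hx' h')
      (fun h' => hd2 y k (k - 1) (by simp) hy' h'.symm) (hn _ _ ?_) (e := v (k + 4))
      (fun h' => hd3 x (k + 1) hx' (by convert h'.symm using 2; ring)) (hn _ _ ?_)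
      (fun h' => hd3 y (k + 4) h'.symm (by convert hy' using 2; ring_nf; reduce_mod_char))
      (hn _ _ ?_)
    all_goals clear * -; revert k; decide
  have := HasOrder.of_letters (G := H) (fun _ => (0 : ℕ)) c
    (fun i j => j = i + 1 ∨ i = j + 1) fun x y _ _ => ?_
  · exact this.mono (by simp)
  · have : c y = c x + 1 ∨ c x = c y + 1 ∨ c x = c y ∨ c y = c x + 2 ∨ c x = c y + 2 ∨
        c y = c x + 3 ∨ c x = c y + 3 := by
      generalize c x = i
      generalize c y = j
      clear * -
      revert i j
      decide
    have hiff : ∀ {i j : ZMod 7}, c x = i → c y = j → ¬ H.Adj x y → ¬ (j = i + 1 ∨ i = j + 1) →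
        (H.Adj x y ↔ (c y = c x + 1 ∨ c x = c y + 1)) := by
      rintro i j rfl rfl h1 h2
      tauto
    rcases this with h | h | h | h | h | h | h
    · simp [key1 x y h, h]
    · simp [(key1 y x h).symm, h]
    · refine hiff rfl rfl (key x y h) ?_
      rw [h]
      generalize c y = j
      clear * -
      revert j
      decide
    · refine hiff rfl rfl (key2 x y h) ?_
      rw [h]
      generalize c x = j
      clear * -
      revert j
      decide
    · refine hiff rfl rfl (fun h' => key2 y x h h'.symm) ?_
      rw [h]
      generalize c y = j
      clear * -
      revert j
      decide
    · refine hiff rfl rfl (key3 x y h) ?_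
      rw [h]
      generalize c x = j
      clear * -
      revert j
      decide
    · refine hiff rfl rfl (fun h' => key3 y x h h'.symm) ?_
      rw [h]
      generalize c y = j
      clear * -
      revert j
      decide

/-! ### Vertices relative to a five-cycle -/

/-- A closed walk of length five in a graph without triangle and co-wheel. -/
structure FiveFrame (H : SimpleGraph V) (v : ZMod 5 → V) : Prop where
  triangleFree : H.TriangleFree
  coWheelFree : H.CoWheelFree
  adj_succ : ∀ i, H.Adj (v i) (v (i + 1))

/-- The vertex `x` has the same two neighbours on the five-cycle as `v i`. -/
def IsClone (H : SimpleGraph V) (v : ZMod 5 → V) (i : ZMod 5) (x : V) : Prop :=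
  H.Adj x (v (i + 4)) ∧ H.Adj x (v (i + 1))

/-- The vertex `v i` is the only neighbour of `x` on the five-cycle. -/
def IsPendant (H : SimpleGraph V) (v : ZMod 5 → V) (i : ZMod 5) (x : V) : Prop :=
  H.Adj x (v i) ∧ ∀ j, j ≠ i → ¬ H.Adj x (v j)

/-- The vertex `x` has no neighbour on the five-cycle. -/
def IsRemote (H : SimpleGraph V) (v : ZMod 5 → V) (x : V) : Prop :=
  ∀ j, ¬ H.Adj x (v j)

namespace FiveFrame

variable {H : SimpleGraph V} {v : ZMod 5 → V}

theorem adj_iff (F : H.FiveFrame v) {i j : ZMod 5} : H.Adj (v i) (v j) ↔ j = i + 1 ∨ i = j + 1 := by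
  constructor
  · intro h
    have : j = i ∨ j = i + 1 ∨ i = j + 1 ∨ j = i + 2 ∨ i = j + 2 := by
      clear * -
      revert i j
      decide
    have key : ∀ k, ¬ H.Adj (v k) (v (k + 2)) := fun k hk =>
      F.triangleFree (F.adj_succ k) (by convert F.adj_succ (k + 1) using 2; ring) hk
    rcases this with rfl | h1 | h1 | rfl | rfl
    · exact (H.loopless.1 _ h).elim
    · exact Or.inl h1
    · exact Or.inr h1
    · exact (key _ h).elim
    · exact (key _ h.symm).elim
  · rintro (rfl | rfl)
    · exact F.adj_succ i
    · exact (F.adj_succ j).symm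

theorem not_adj_of_adj (F : H.FiveFrame v) {x : V} {i j : ZMod 5} (h : H.Adj x (v i))
    (hij : j = i + 1 ∨ i = j + 1) :
    ¬ H.Adj x (v j) :=
  fun h' => F.triangleFree h (F.adj_iff.2 hij) h'

theorem clone_adj_iff (F : H.FiveFrame v) {x : V} {i j : ZMod 5} (hx : H.IsClone v i x) :
    H.Adj x (v j) ↔ j = i + 4 ∨ j = i + 1 := by
  constructor
  · intro h
    by_contra hne
    have : (j = i + 1 + 1 ∨ i + 1 = j + 1) ∨ (j = i + 4 + 1 ∨ i + 4 = j + 1) := by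
      clear * - hne
      revert i j
      decide
    rcases this with h1 | h1
    · exact F.not_adj_of_adj hx.2 h1 h
    · exact F.not_adj_of_adj hx.1 h1 h
  · rintro (rfl | rfl)
    exacts [hx.1, hx.2]

theorem clone_unique (F : H.FiveFrame v) {x : V} {i j : ZMod 5} (hi : H.IsClone v i x)
    (hj : H.IsClone v j x) :
    i = j := by
  have h1 := (F.clone_adj_iff hi).1 hj.1
  have h2 := (F.clone_adj_iff hi).1 hj.2
  clear * - h1 h2
  revert i j
  decide

theorem trichotomy (F : H.FiveFrame v) (x : V) :
    (∃ i, H.IsClone v i x) ∨ (∃ i, H.IsPendant v i x) ∨ H.IsRemote v x := by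
  by_cases h : H.IsRemote v x
  · exact Or.inr (Or.inr h)
  unfold IsRemote at h
  push Not at h
  obtain ⟨i, hi⟩ := h
  by_cases hp : H.IsPendant v i x
  · exact Or.inr (Or.inl ⟨i, hp⟩)
  unfold IsPendant at hp
  push Not at hp
  obtain ⟨j, hj, hxj⟩ := hp hi
  left
  have : (j = i + 1 ∨ i = j + 1) ∨ j = i + 2 ∨ j = i + 3 := by
    clear * - hj
    revert i j
    decide
  rcases this with h | rfl | rfl
  · exact (F.not_adj_of_adj hi h hxj).elim
  · refine ⟨i + 1, ?_, ?_⟩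
    · convert hi using 2
      clear * -; revert i; decide
    · convert hxj using 2
      ring
  · refine ⟨i + 4, ?_, ?_⟩
    · convert hxj using 2
      clear * -; revert i; decide
    · convert hi using 2
      clear * -; revert i; decide

theorem clone_not_adj_pendant (F : H.FiveFrame v) {i j : ZMod 5} {x y : V} (hx : H.IsClone v i x)
    (hy : H.IsPendant v j y) (hij : j = i + 1 ∨ i = j + 1) : ¬ H.Adj x y := by
  intro h
  refine F.triangleFree h hy.1 ((F.clone_adj_iff hx).2 ?_)
  clear * - hij
  revert i j
  decide

theorem clone_not_adj (F : H.FiveFrame v) {i j : ZMod 5} {x y : V} (hx : H.IsClone v i x)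
    (hy : H.IsClone v j y)
    (hij : ¬ (j = i + 1 ∨ i = j + 1)) : ¬ H.Adj x y := by
  intro h
  have : ∃ k, (k = i + 4 ∨ k = i + 1) ∧ (k = j + 4 ∨ k = j + 1) := by
    clear * - hij
    revert i j
    decide
  obtain ⟨k, h1, h2⟩ := this
  exact F.triangleFree h ((F.clone_adj_iff hy).2 h2) ((F.clone_adj_iff hx).2 h1)

/-- Equal attachments give a triangle. For attachments at distance two, the co-wheel consists of
`xy`, the cycle edge avoiding both attachments, and the cycle vertex between them. -/
theorem pendant_not_adj (F : H.FiveFrame v) {i j : ZMod 5} {x y : V} (hx : H.IsPendant v i x)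
    (hy : H.IsPendant v j y) (hij : ¬ (j = i + 1 ∨ i = j + 1)) : ¬ H.Adj x y := by
  intro h
  by_cases he : j = i
  · subst he
    exact F.triangleFree h hy.1 hx.1
  obtain ⟨k, l, m, h1, h2, h3, h4, h5, h6, h7, h8, h9⟩ : ∃ k l m : ZMod 5, l = k + 1 ∧ k ≠ i ∧
      l ≠ i ∧ k ≠ j ∧ l ≠ j ∧ ¬ (k = m + 1 ∨ m = k + 1) ∧ ¬ (l = m + 1 ∨ m = l + 1) ∧
      m ≠ i ∧ m ≠ j := by
    clear * - hij he
    revert i j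
    decide
  exact F.coWheelFree (e := v m) h (F.adj_iff.2 (Or.inl h1)) (hx.2 k h2) (hx.2 l h3) (hy.2 k h4)
    (hy.2 l h5) (fun h => hx.2 m h8 h.symm) (fun h => hy.2 m h9 h.symm) (mt F.adj_iff.1 h6)
    (mt F.adj_iff.1 h7)

theorem remote_not_adj (F : H.FiveFrame v) {x y : V} (hx : H.IsRemote v x) : ¬ H.Adj x y := by
  intro h
  have key : ∀ k l m : ZMod 5, l = k + 1 → ¬ (k = m + 1 ∨ m = k + 1) → ¬ (l = m + 1 ∨ m = l + 1) →
      ¬ H.Adj y (v k) → ¬ H.Adj y (v l) → ¬ H.Adj y (v m) → False :=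
    fun k l m h1 h2 h3 hk hl hm => F.coWheelFree (e := v m) h (F.adj_iff.2 (Or.inl h1)) (hx k)
      (hx l) hk hl (fun h => hx m h.symm) (fun h => hm h.symm) (mt F.adj_iff.1 h2)
      (mt F.adj_iff.1 h3)
  rcases F.trichotomy y with ⟨i, hy⟩ | ⟨i, hy⟩ | hy
  · refine key (i + 2) (i + 3) i ?_ ?_ ?_ (mt (F.clone_adj_iff hy).1 ?_)
      (mt (F.clone_adj_iff hy).1 ?_) (mt (F.clone_adj_iff hy).1 ?_) <;>
    (clear * -; revert i; decide)
  · refine key (i + 1) (i + 2) (i + 4) ?_ ?_ ?_ (hy.2 _ ?_) (hy.2 _ ?_) (hy.2 _ ?_) <;>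
    (clear * -; revert i; decide)
  · exact key 0 1 3 (by decide) (by decide) (by decide) (hy _) (hy _) (hy _)

theorem pendant_adj_pendant (F : H.FiveFrame v) {i j : ZMod 5} {x y : V} (hx : H.IsPendant v i x)
    (hy : H.IsPendant v j y) (hij : j = i + 1) : H.Adj x y := by
  by_contra h
  refine F.coWheelFree (e := y) hx.1 (F.adj_succ (i + 2)) (hx.2 _ ?_) (hx.2 _ ?_)
    (mt F.adj_iff.1 ?_) (mt F.adj_iff.1 ?_) (fun h' => h h'.symm) (hy.2 _ ?_) (hy.2 _ ?_)
    (hy.2 _ ?_) <;>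
  (clear * - hij; revert i j; decide)

theorem clone_adj_pendant (F : H.FiveFrame v) {i : ZMod 5} {x y : V} (hx : H.IsClone v i x)
    (hy : H.IsPendant v i y) : H.Adj x y := by
  by_contra h
  refine F.coWheelFree (e := x) hy.1 (F.adj_succ (i + 2)) (hy.2 _ ?_) (hy.2 _ ?_)
    (mt F.adj_iff.1 ?_) (mt F.adj_iff.1 ?_) h (mt (F.clone_adj_iff hx).1 ?_)
    (mt (F.clone_adj_iff hx).1 ?_) (mt (F.clone_adj_iff hx).1 ?_) <;>
  (clear * -; revert i; decide)

/-- Otherwise `x v (i + 4)`, `y v (j + 1)` and `z` form a co-wheel. Hence no clone has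
non-neighbours in both neighbouring classes. -/
theorem clone_adj_or (F : H.FiveFrame v) {i j k : ZMod 5} {x y z : V} (hx : H.IsClone v i x)
    (hy : H.IsClone v j y)
    (hz : H.IsClone v k z) (hij : j = i + 1) (hjk : k = j + 1) : H.Adj x y ∨ H.Adj y z := by
  by_contra h
  rw [not_or] at h
  refine F.coWheelFree (e := z) hx.1 hy.2 h.1 (mt (F.clone_adj_iff hx).1 ?_)
    (fun h' => mt (F.clone_adj_iff hy).1 ?_ h'.symm) (mt F.adj_iff.1 ?_)
    (F.clone_not_adj hz hx ?_) (mt (F.clone_adj_iff hz).1 ?_) (fun h' => h.2 h'.symm)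
    (mt (F.clone_adj_iff hz).1 ?_) <;>
  (clear * - hij hjk; revert i j k; decide)

/-- The cycle vertex `v (i + 3)` misses all four clones, so two disjoint induced edges would
complete a co-wheel: neighbourhoods are nested. -/
theorem clone_chain (F : H.FiveFrame v) {i j : ZMod 5} {x x' y y' : V} (hx : H.IsClone v i x)
    (hx' : H.IsClone v i x')
    (hy : H.IsClone v j y) (hy' : H.IsClone v j y') (hij : j = i + 1) (h : H.Adj x y)
    (h' : H.Adj x' y') : H.Adj x y' ∨ H.Adj x' y := by
  by_contra hne
  rw [not_or] at hne
  have e1 : ¬ H.Adj x (v (i + 3)) := by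
    rw [F.clone_adj_iff hx]; clear * -; revert i; decide
  have e2 : ¬ H.Adj x' (v (i + 3)) := by
    rw [F.clone_adj_iff hx']; clear * -; revert i; decide
  have e3 : ¬ H.Adj y (v (i + 3)) := by
    rw [F.clone_adj_iff hy]; clear * - hij; revert i j; decide
  have e4 : ¬ H.Adj y' (v (i + 3)) := by
    rw [F.clone_adj_iff hy']; clear * - hij; revert i j; decide
  exact F.coWheelFree (e := v (i + 3)) h h' (F.clone_not_adj hx hx' (by simp; decide)) hne.1
    (fun h => hne.2 h.symm) (F.clone_not_adj hy hy' (by simp; decide)) (fun h => e1 h.symm)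
    (fun h => e3 h.symm) (fun h => e2 h.symm) (fun h => e4 h.symm)

theorem pendant_chain (F : H.FiveFrame v) {i j : ZMod 5} {x x' y y' : V} (hx : H.IsPendant v i x)
    (hx' : H.IsPendant v i x') (hy : H.IsClone v j y) (hy' : H.IsClone v j y')
    (hij : j = i + 2 ∨ j = i + 3) (h : H.Adj x y) (h' : H.Adj x' y') :
    H.Adj x y' ∨ H.Adj x' y := by
  by_contra hne
  rw [not_or] at hne
  have hji : j ≠ i := by
    clear * - hij; revert i j; decide
  have e3 : ∀ {y}, H.IsClone v j y → ¬ H.Adj y (v j) := by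
    intro y hy
    rw [F.clone_adj_iff hy]; clear * -; revert j; decide
  exact F.coWheelFree (e := v j) h h' (F.pendant_not_adj hx hx' (by simp; decide)) hne.1
    (fun h => hne.2 h.symm) (F.clone_not_adj hy hy' (by simp; decide)) (fun h => hx.2 j hji h.symm)
    (fun h => e3 hy h.symm) (fun h => hx'.2 j hji h.symm) (fun h => e3 hy' h.symm)

theorem adj_of_pendant_clone_clone (F : H.FiveFrame v) {i j k : ZMod 5} {u x y : V}
    (hu : H.IsPendant v k u)
    (hx : H.IsClone v i x) (hy : H.IsClone v j y) (hij : j = i + 1) (hik : k = i + 3)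
    (hux : ¬ H.Adj u x) (huy : ¬ H.Adj u y) : H.Adj x y := by
  by_contra hxy
  refine F.coWheelFree (e := y) hu.1 hx.2 hux (hu.2 _ ?_)
    (fun h => mt (F.clone_adj_iff hx).1 ?_ h.symm) (mt F.adj_iff.1 ?_) (fun h => huy h.symm)
    (mt (F.clone_adj_iff hy).1 ?_) (fun h => hxy h.symm) (mt (F.clone_adj_iff hy).1 ?_) <;>
  (clear * - hij hik; revert i j k; decide)

/-- Non-neighbours of a clone in a class not attached to `u` bound the neighbours of `u`. -/
theorem pendant_adj_of_clone (F : H.FiveFrame v) {i j k : ZMod 5} {u x y z : V}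
    (hu : H.IsPendant v k u)
    (hx : H.IsClone v i x) (hz : H.IsClone v i z) (hy : H.IsClone v j y)
    (hijk : (j = i + 4 ∧ k = i + 3) ∨ (j = i + 1 ∧ k = i + 2)) (hux : H.Adj u x)
    (hxy : ¬ H.Adj x y) (hzy : H.Adj z y) : H.Adj u z := by
  by_contra huz
  -- The only cycle vertex missing `u`, `x`, `y`, `z`: `m` is `i + 2` or `i + 3`.
  obtain ⟨m, h1, h2, h3, h4⟩ : ∃ m, m ≠ k ∧ ¬ (m = i + 4 ∨ m = i + 1) ∧
      ¬ (m = j + 4 ∨ m = j + 1) ∧ (k = j + 1 ∨ j = k + 1) := by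
    clear * - hijk
    revert i j k
    decide
  exact F.coWheelFree (e := v m) hux hzy huz (fun h => F.clone_not_adj_pendant hy hu h4 h.symm)
    (F.clone_not_adj hx hz (by simp; decide)) hxy (fun h => hu.2 m h1 h.symm)
    (fun h => h2 ((F.clone_adj_iff hx).1 h.symm)) (fun h => h2 ((F.clone_adj_iff hz).1 h.symm))
    (fun h => h3 ((F.clone_adj_iff hy).1 h.symm))

end FiveFrame

/-! ### Sorting the clones -/

/-- A clone of `v i` with a non-neighbour among the clones of `v (i + 1)`. -/
def IsRight (H : SimpleGraph V) (v : ZMod 5 → V) (i : ZMod 5) (x : V) : Prop :=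
  H.IsClone v i x ∧ ∃ y, H.IsClone v (i + 1) y ∧ ¬ H.Adj x y

/-- A clone of `v i` with a non-neighbour among the clones of `v (i - 1)`. -/
def IsLeft (H : SimpleGraph V) (v : ZMod 5 → V) (i : ZMod 5) (x : V) : Prop :=
  H.IsClone v i x ∧ ∃ y, H.IsClone v (i + 4) y ∧ ¬ H.Adj x y

/-- A clone of `v i` adjacent to all clones of `v (i - 1)` and `v (i + 1)`. -/
def IsCentral (H : SimpleGraph V) (v : ZMod 5 → V) (i : ZMod 5) (x : V) : Prop :=
  H.IsClone v i x ∧ ¬ H.IsRight v i x ∧ ¬ H.IsLeft v i x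

/-- The three kinds of clones. -/
def CloneKind (H : SimpleGraph V) (v : ZMod 5 → V) (i : ZMod 5) : Fin 3 → V → Prop :=
  ![H.IsRight v i, H.IsLeft v i, H.IsCentral v i]

namespace FiveFrame

variable {H : SimpleGraph V} {v : ZMod 5 → V}

theorem not_left_of_right (F : H.FiveFrame v) {i : ZMod 5} {x : V} (h : H.IsRight v i x) :
    ¬ H.IsLeft v i x := by
  rintro ⟨hx, y, hy, hxy⟩
  obtain ⟨-, z, hz, hxz⟩ := h
  rcases F.clone_adj_or hy hx hz (by clear * -; revert i; decide) rfl with h | h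
  · exact hxy h.symm
  · exact hxz h

theorem adj_of_not_right {i : ZMod 5} {x y : V} (hx : H.IsClone v i x) (h : ¬ H.IsRight v i x)
    (hy : H.IsClone v (i + 1) y) : H.Adj x y := by
  by_contra hxy
  exact h ⟨hx, y, hy, hxy⟩

theorem adj_of_not_left {i j : ZMod 5} {x y : V} (hx : H.IsClone v i x) (h : ¬ H.IsLeft v i x)
    (hy : H.IsClone v j y) (hij : i = j + 1) : H.Adj x y := by
  by_contra hxy
  refine h ⟨hx, y, ?_, hxy⟩
  convert hy
  clear * - hij
  revert i j
  decide

theorem cloneKind_isClone {i : ZMod 5} {k : Fin 3} {x : V} (h : H.CloneKind v i k x) :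
    H.IsClone v i x := by
  fin_cases k
  exacts [h.1, h.1, h.1]

theorem exists_cloneKind {i : ZMod 5} {x : V} (h : H.IsClone v i x) :
    ∃ k, H.CloneKind v i k x := by
  by_cases h0 : H.IsRight v i x
  · exact ⟨0, h0⟩
  by_cases h1 : H.IsLeft v i x
  · exact ⟨1, h1⟩
  exact ⟨2, h, h0, h1⟩

/-- A numbering of the vertices that sorts the clones. -/
theorem exists_clone_order [Finite V] (F : H.FiveFrame v) : ∃ p : V → ℕ,
    (∀ i r l, H.IsRight v i r → H.IsLeft v (i + 1) l →
      (H.Adj r l → p r < p l) ∧ (¬ H.Adj r l → p l < p r)) ∧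
    ∀ i k x y, H.CloneKind v i k x → H.CloneKind v i k y → p x ≤ p y →
      (∀ u, H.IsPendant v (i + 3) u → ¬ H.Adj u y → ¬ H.Adj u x) ∧
      (∀ u, H.IsPendant v (i + 2) u → H.Adj u y → H.Adj u x) := by
  classical
  have := Fintype.ofFinite V
  let A : V → Finset V := fun x =>
    {y | ∃ i, H.IsClone v i x ∧ H.IsClone v (i + 1) y ∧ ¬ H.Adj x y}
  let B : V → Finset V := fun y =>
    {x | ∃ i, H.IsClone v i x ∧ H.IsClone v (i + 1) y ∧ H.Adj x y}
  let C : V → Finset V := fun x => {u | ∃ i, H.IsClone v i x ∧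
    (H.IsPendant v (i + 3) u ∧ H.Adj u x ∨ H.IsPendant v (i + 2) u ∧ ¬ H.Adj u x)}
  have hA : ∀ {i x y}, H.IsClone v i x →
      (y ∈ A x ↔ H.IsClone v (i + 1) y ∧ ¬ H.Adj x y) := by
    intro i x y hx
    simp only [A, mem_filter, mem_univ, true_and]
    refine ⟨fun ⟨j, hj, h⟩ => ?_, fun h => ⟨i, hx, h⟩⟩
    rwa [F.clone_unique hx hj]
  have hB : ∀ {i x y}, H.IsClone v (i + 1) y → (x ∈ B y ↔ H.IsClone v i x ∧ H.Adj x y) := by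
    intro i x y hy
    simp only [B, mem_filter, mem_univ, true_and]
    refine ⟨fun ⟨j, hj, hj', h⟩ => ?_, fun h => ⟨i, h.1, hy, h.2⟩⟩
    rw [add_right_cancel (F.clone_unique hy hj')]
    exact ⟨hj, h⟩
  have hC : ∀ {i x u}, H.IsClone v i x → (u ∈ C x ↔
      (H.IsPendant v (i + 3) u ∧ H.Adj u x ∨ H.IsPendant v (i + 2) u ∧ ¬ H.Adj u x)) := by
    intro i x u hx
    simp only [C, mem_filter, mem_univ, true_and]
    refine ⟨fun ⟨j, hj, h⟩ => ?_, fun h => ⟨i, hx, h⟩⟩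
    rwa [F.clone_unique hx hj]
  -- A right clone sits at its number of non-neighbours in the next class, a left clone at the
  -- largest such number among its neighbours in the previous class. Ties put left clones later,
  -- then `C` sorts by pendant neighbourhoods. Central clones have empty `A`.
  let b : V → ℕ := fun x => (B x).sup fun w => #(A w)
  let pos : V → ℕ ×ₗ ℕ ×ₗ ℕ := fun x => if ∃ i, H.IsLeft v i x then toLex (b x, toLex (1, #(C x)))
    else toLex (#(A x), toLex (0, #(C x)))
  have hleft : ∀ {i x}, H.IsLeft v i x → pos x = toLex (b x, toLex (1, #(C x))) :=
    fun {i x} h => if_pos ⟨i, h⟩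
  have hnleft : ∀ {i x}, H.IsClone v i x → ¬ H.IsLeft v i x →
      pos x = toLex (#(A x), toLex (0, #(C x))) := by
    intro i x hx h
    refine if_neg ?_
    rintro ⟨j, hj⟩
    rw [F.clone_unique hx hj.1] at h
    exact h hj
  obtain ⟨p, -, hp⟩ := exists_injective_refining pos
  have hlt : ∀ {x y}, pos x < pos y → p x < p y := by
    intro x y h
    by_contra h'
    exact absurd (hp _ _ (not_lt.1 h')) (not_le.2 h)
  -- neighbourhoods of the pendant vertices in the clones of one vertex are nested
  have hCsub : ∀ {i x y}, H.IsClone v i x → H.IsClone v i y → #(C x) ≤ #(C y) → C x ⊆ C y := by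
    intro i x y hx hy hcard u hu
    by_contra huy
    have hsub : C y ⊆ C x := by
      intro u' hu'
      by_contra hux
      rw [hC hx] at hu hux
      rw [hC hy] at hu' huy
      have e : i + 3 = i + 2 + 1 := by ring
      rcases hu with ⟨h1, h2⟩ | ⟨h1, h2⟩ <;> rcases hu' with ⟨h3, h4⟩ | ⟨h3, h4⟩
      · rcases F.pendant_chain h1 h3 hx hy (by clear * -; revert i; decide) h2 h4 with h | h <;>
        tauto
      · have h5 : H.Adj u' x := by tauto
        exact F.triangleFree (F.pendant_adj_pendant h3 h1 e) h2 h5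
      · have h5 : H.Adj u y := by tauto
        exact F.triangleFree (F.pendant_adj_pendant h1 h3 e) h4 h5
      · have h5 : H.Adj u y := by tauto
        have h6 : H.Adj u' x := by tauto
        rcases F.pendant_chain h1 h3 hy hx (by clear * -; revert i; decide) h5 h6 with h | h <;>
        tauto
    have := Finset.eq_of_subset_of_card_le hsub hcard
    exact huy (this ▸ hu)
  have hCle : ∀ {i x y}, H.IsClone v i x → H.IsClone v i y → #(C x) ≤ #(C y) →
      (∀ u, H.IsPendant v (i + 3) u → ¬ H.Adj u y → ¬ H.Adj u x) ∧
      (∀ u, H.IsPendant v (i + 2) u → H.Adj u y → H.Adj u x) := by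
    intro i x y hx hy hcard
    have hsub := hCsub hx hy hcard
    have hne : ∀ u, H.IsPendant v (i + 3) u → ¬ H.IsPendant v (i + 2) u := fun u h h' =>
      h'.2 (i + 3) (by clear * -; revert i; decide) h.1
    refine ⟨fun u hu huy hux => ?_, fun u hu huy => ?_⟩
    · have h1 := hsub ((hC hx).2 (Or.inl ⟨hu, hux⟩))
      rw [hC hy] at h1
      have := hne u hu
      tauto
    · by_contra hux
      have h1 := hsub ((hC hx).2 (Or.inr ⟨hu, hux⟩))
      rw [hC hy] at h1
      have := hne u
      tauto
  have hAlt : ∀ {i x y}, H.IsClone v i x → H.IsClone v i y → #(A x) < #(A y) →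
      (∀ u, H.IsPendant v (i + 3) u → ¬ H.Adj u y → ¬ H.Adj u x) ∧
      (∀ u, H.IsPendant v (i + 2) u → H.Adj u y → H.Adj u x) := by
    intro i x y hx hy hcard
    -- This `w` in the next class is adjacent to `x` but not to `y`.
    obtain ⟨w, hw, hwx⟩ : ∃ w ∈ A y, w ∉ A x := by
      by_contra h
      push Not at h
      exact absurd (card_le_card h) (not_le.2 hcard)
    rw [hA hy] at hw
    rw [hA hx] at hwx
    have hxw : H.Adj x w := by tauto
    refine ⟨fun u hu huy hux => ?_, fun u hu huy => ?_⟩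
    · by_cases huw : H.Adj u w
      · exact F.triangleFree hux hxw huw
      · exact hw.2 (F.adj_of_pendant_clone_clone hu hy hw.1 rfl rfl huy huw)
    · exact F.pendant_adj_of_clone hu hy hx hw.1 (Or.inr ⟨rfl, rfl⟩) huy hw.2 hxw
  have hblt : ∀ {i x y}, H.IsClone v i x → H.IsClone v i y → b x < b y →
      (∀ u, H.IsPendant v (i + 3) u → ¬ H.Adj u y → ¬ H.Adj u x) ∧
      (∀ u, H.IsPendant v (i + 2) u → H.Adj u y → H.Adj u x) := by
    intro i x y hx hy hcard
    -- Now `w`, in the previous class, is adjacent to `y`; it misses `x` because its count exceeds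
    -- `b x`.
    obtain ⟨w, hw, hwx⟩ := Finset.lt_sup_iff.1 hcard
    have e : i + 4 + 1 = i := by clear * -; revert i; decide
    rw [← e] at hx hy
    have hw' := (hB hy).1 hw
    have hxw : ¬ H.Adj w x := by
      intro h
      have h1 : w ∈ B x := (hB hx).2 ⟨hw'.1, h⟩
      exact absurd (Finset.le_sup (f := fun w => #(A w)) h1) (not_le.2 hwx)
    refine ⟨fun u hu huy hux => huy ?_, fun u hu huy => ?_⟩
    · refine F.pendant_adj_of_clone hu hx hy hw'.1 (Or.inl ⟨?_, ?_⟩) hux (fun h => hxw h.symm)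
        hw'.2.symm <;> (clear * -; revert i; decide)
    · by_contra hux
      refine hxw (F.adj_of_pendant_clone_clone hu hw'.1 hx rfl ?_ (fun h => ?_) hux)
      · clear * -; revert i; decide
      · exact F.triangleFree h hw'.2 huy
  refine ⟨p, fun i r l hr hl => ?_, fun i k x y hx hy hxy => ?_⟩
  · have hr' := hnleft hr.1 (F.not_left_of_right hr)
    refine ⟨fun h => hlt ?_, fun h => hlt ?_⟩
    · rw [hr', hleft hl, Prod.Lex.toLex_lt_toLex]
      have h1 : #(A r) ≤ b l := Finset.le_sup (f := fun w => #(A w)) ((hB hl.1).2 ⟨hr.1, h⟩)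
      rcases h1.lt_or_eq with h2 | h2
      · exact Or.inl h2
      · exact Or.inr ⟨h2, Prod.Lex.toLex_lt_toLex.2 (Or.inl Nat.zero_lt_one)⟩
    · rw [hr', hleft hl, Prod.Lex.toLex_lt_toLex]
      left
      have hlA : l ∈ A r := (hA hr.1).2 ⟨hl.1, h⟩
      refine (Finset.sup_lt_iff ?_).2 fun w hw => ?_
      · exact card_pos.2 ⟨l, hlA⟩
      · rw [hB hl.1] at hw
        refine card_lt_card (Finset.ssubset_iff_subset_ne.2 ⟨fun y hy => ?_, fun he => ?_⟩)
        · rw [hA hw.1] at hy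
          refine (hA hr.1).2 ⟨hy.1, fun hry => ?_⟩
          rcases F.clone_chain hw.1 hr.1 hl.1 hy.1 rfl hw.2 hry with h1 | h1
          exacts [hy.2 h1, h h1]
        · rw [← he, hA hw.1] at hlA
          exact hlA.2 hw.2
  · have hx' := cloneKind_isClone hx
    have hy' := cloneKind_isClone hy
    have hpos := hp _ _ hxy
    have hcases : H.IsLeft v i x ∧ H.IsLeft v i y ∨ ¬ H.IsLeft v i x ∧ ¬ H.IsLeft v i y := by
      fin_cases k
      · exact Or.inr ⟨F.not_left_of_right hx, F.not_left_of_right hy⟩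
      · exact Or.inl ⟨hx, hy⟩
      · exact Or.inr ⟨hx.2.2, hy.2.2⟩
    rcases hcases with ⟨h1, h2⟩ | ⟨h1, h2⟩
    · rw [hleft h1, hleft h2] at hpos
      simp only [Prod.Lex.toLex_le_toLex, lt_irrefl, false_or, true_and] at hpos
      rcases hpos with h | h
      · exact hblt hx' hy' h
      · exact hCle hx' hy' h.2
    · rw [hnleft hx' h1, hnleft hy' h2] at hpos
      simp only [Prod.Lex.toLex_le_toLex, lt_irrefl, false_or, true_and] at hpos
      rcases hpos with h | h
      · exact hAlt hx' hy' h
      · exact hCle hx' hy' h.2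

end FiveFrame

/-! ### Inserting the pendant vertices -/

/-- The five kinds of pendant vertices at `v (i + 3)`, according to where the boundary between
their neighbours and non-neighbours among the clones of `v i` and `v (i + 1)` lies. -/
def PendantKind (H : SimpleGraph V) (v : ZMod 5 → V) (i : ZMod 5) : Fin 5 → V → Prop :=
  ![fun u => H.IsPendant v (i + 3) u ∧ (∃ x, H.IsClone v i x ∧ H.Adj u x) ∧
      ∃ y, H.IsClone v (i + 1) y ∧ H.Adj u y,
    fun u => H.IsPendant v (i + 3) u ∧ (∀ y, H.IsClone v (i + 1) y → ¬ H.Adj u y) ∧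
      ∃ x, H.IsLeft v i x ∧ H.Adj u x,
    fun u => H.IsPendant v (i + 3) u ∧ (∀ y, H.IsClone v (i + 1) y → ¬ H.Adj u y) ∧
      ∀ x, H.IsLeft v i x → ¬ H.Adj u x,
    fun u => H.IsPendant v (i + 3) u ∧ (∀ x, H.IsClone v i x → ¬ H.Adj u x) ∧
      ∃ y, H.IsRight v (i + 1) y ∧ H.Adj u y,
    fun u => H.IsPendant v (i + 3) u ∧ (∀ x, H.IsClone v i x → ¬ H.Adj u x) ∧
      ∀ y, H.IsRight v (i + 1) y → ¬ H.Adj u y]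

/-- The clones to be placed before a pendant vertex `u` of the given kind. -/
def Before (H : SimpleGraph V) (v : ZMod 5 → V) (i : ZMod 5) : Fin 5 → V → V → Prop :=
  ![fun u x => H.IsRight v i x ∧ ¬ H.Adj u x ∨ H.IsLeft v (i + 1) x ∧ H.Adj u x,
    fun u x => H.IsLeft v i x ∧ ¬ H.Adj u x,
    fun u x => H.IsCentral v i x ∧ ¬ H.Adj u x,
    fun u x => H.IsRight v (i + 1) x ∧ H.Adj u x,
    fun u x => H.IsCentral v (i + 1) x ∧ H.Adj u x]

/-- The clones to be placed after a pendant vertex `u` of the given kind. -/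
def After (H : SimpleGraph V) (v : ZMod 5 → V) (i : ZMod 5) : Fin 5 → V → V → Prop :=
  ![fun u x => H.IsRight v i x ∧ H.Adj u x ∨ H.IsLeft v (i + 1) x ∧ ¬ H.Adj u x,
    fun u x => H.IsLeft v i x ∧ H.Adj u x,
    fun u x => H.IsCentral v i x ∧ H.Adj u x,
    fun u x => H.IsRight v (i + 1) x ∧ ¬ H.Adj u x,
    fun u x => H.IsCentral v (i + 1) x ∧ ¬ H.Adj u x]

/-- Kinds of vertices relative to a five-cycle; `none` stands for the isolated vertices. -/
abbrev Letter := Option (ZMod 5 × (Fin 3 ⊕ Fin 5))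

/-- The vertex `x` is of the kind described by the letter. -/
def HasLetter (H : SimpleGraph V) (v : ZMod 5 → V) : Letter → V → Prop
  | none => H.IsRemote v
  | some (i, .inl k) => H.CloneKind v i k
  | some (i, .inr k) => H.PendantKind v i k

/-- Adjacency between `A` and `B` is constant or given by comparing keys. -/
def KeyDetermined (H : SimpleGraph V) (key : V → ℕ) (A B : V → Prop) : Prop :=
  (∀ x y, A x → B y → H.Adj x y) ∨ (∀ x y, A x → B y → ¬ H.Adj x y) ∨
  (∀ x y, A x → B y → (H.Adj x y → key x < key y) ∧ (¬ H.Adj x y → key y < key x)) ∨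
  (∀ x y, A x → B y → (H.Adj x y → key y < key x) ∧ (¬ H.Adj x y → key x < key y))

theorem KeyDetermined.symm {H : SimpleGraph V} {key : V → ℕ} {A B : V → Prop}
    (h : H.KeyDetermined key A B) : H.KeyDetermined key B A := by
  rcases h with h | h | h | h
  · exact Or.inl fun x y hx hy => (h y x hy hx).symm
  · exact Or.inr (Or.inl fun x y hx hy hxy => h y x hy hx hxy.symm)
  · refine Or.inr (Or.inr (Or.inr fun x y hx hy => ?_))
    rw [H.adj_comm]
    exact h y x hy hx
  · refine Or.inr (Or.inr (Or.inl fun x y hx hy => ?_))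
    rw [H.adj_comm]
    exact h y x hy hx

theorem KeyDetermined.exists_iff {H : SimpleGraph V} {key : V → ℕ} {A B : V → Prop}
    (h : H.KeyDetermined key A B) :
    ∃ t : Prop, ∀ x y, A x → B y → key x ≤ key y → (H.Adj x y ↔ t) := by
  rcases h with h | h | h | h
  · exact ⟨True, fun x y hx hy _ => by simpa using h x y hx hy⟩
  · exact ⟨False, fun x y hx hy _ => by simpa using h x y hx hy⟩
  · refine ⟨True, fun x y hx hy hk => ?_⟩
    by_contra hn
    have := (h x y hx hy).2 (by tauto)
    omega
  · refine ⟨False, fun x y hx hy hk => ?_⟩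
    by_contra hn
    have := (h x y hx hy).1 (by tauto)
    omega

namespace FiveFrame

variable {H : SimpleGraph V} {v : ZMod 5 → V}

theorem pendantKind_isPendant {i : ZMod 5} {k : Fin 5} {u : V} (h : H.PendantKind v i k u) :
    H.IsPendant v (i + 3) u := by
  fin_cases k
  exacts [h.1, h.1, h.1, h.1, h.1]

theorem exists_pendantKind {i : ZMod 5} {u : V} (h : H.IsPendant v (i + 3) u) :
    ∃ k, H.PendantKind v i k u := by
  by_cases hy : ∀ y, H.IsClone v (i + 1) y → ¬ H.Adj u y
  · by_cases hl : ∃ x, H.IsLeft v i x ∧ H.Adj u x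
    · exact ⟨1, h, hy, hl⟩
    · push Not at hl
      exact ⟨2, h, hy, hl⟩
  by_cases hx : ∀ x, H.IsClone v i x → ¬ H.Adj u x
  · by_cases hr : ∃ y, H.IsRight v (i + 1) y ∧ H.Adj u y
    · exact ⟨3, h, hx, hr⟩
    · push Not at hr
      exact ⟨4, h, hx, hr⟩
  push Not at hx hy
  exact ⟨0, h, hx, hy⟩

theorem exists_letter (F : H.FiveFrame v) (x : V) : ∃ a, H.HasLetter v a x := by
  rcases F.trichotomy x with ⟨i, hx⟩ | ⟨i, hx⟩ | hx
  · obtain ⟨k, hk⟩ := exists_cloneKind hx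
    exact ⟨some (i, .inl k), hk⟩
  · have e : i = i + 2 + 3 := by clear * -; revert i; decide
    rw [e] at hx
    obtain ⟨k, hk⟩ := exists_pendantKind hx
    exact ⟨some (i + 2, .inr k), hk⟩
  · exact ⟨none, hx⟩

/-- This makes room for `u` in the clone order. Within one clone kind it is the monotonicity `h2`;
when a right and a left clone meet, adjacency to `u` decides theirs, and `h1` applies. -/
theorem lt_of_before_of_after (F : H.FiveFrame v) {p : V → ℕ}
    (h1 : ∀ i r l, H.IsRight v i r → H.IsLeft v (i + 1) l →
      (H.Adj r l → p r < p l) ∧ (¬ H.Adj r l → p l < p r))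
    (h2 : ∀ i k x y, H.CloneKind v i k x → H.CloneKind v i k y → p x ≤ p y →
      (∀ u, H.IsPendant v (i + 3) u → ¬ H.Adj u y → ¬ H.Adj u x) ∧
      (∀ u, H.IsPendant v (i + 2) u → H.Adj u y → H.Adj u x))
    {i : ZMod 5} {k : Fin 5} {u x y : V} (hu : H.PendantKind v i k u)
    (hx : H.Before v i k u x) (hy : H.After v i k u y) : p x < p y := by
  by_contra hlt
  rw [not_lt] at hlt
  have hu' := pendantKind_isPendant hu
  have e : i + 3 = i + 1 + 2 := by ring
  have hL : ∀ {m}, H.CloneKind v i m x → H.CloneKind v i m y → ¬ H.Adj u x → ¬ H.Adj u y :=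
    fun hx hy => (h2 _ _ _ _ hy hx hlt).1 u hu'
  have hR : ∀ {m}, H.CloneKind v (i + 1) m x → H.CloneKind v (i + 1) m y → H.Adj u x →
      H.Adj u y :=
    fun hx hy => (h2 _ _ _ _ hy hx hlt).2 u (e ▸ hu')
  fin_cases k
  · rcases hx with hx | hx <;> rcases hy with hy | hy
    · exact hL (m := 0) hx.1 hy.1 hx.2 hy.2
    · refine hx.2 ?_
      by_contra hux
      have h3 := F.adj_of_pendant_clone_clone hu' hx.1.1 hy.1.1 rfl rfl hux hy.2
      exact absurd ((h1 i x y hx.1 hy.1).1 h3) (not_lt.2 hlt)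
    · by_cases h3 : H.Adj y x
      · exact F.triangleFree hy.2 h3 hx.2
      · exact absurd ((h1 i y x hy.1 hx.1).2 h3) (not_lt.2 hlt)
    · exact hy.2 (hR (m := 1) hx.1 hy.1 hx.2)
  · exact hL (m := 1) hx.1 hy.1 hx.2 hy.2
  · exact hL (m := 2) hx.1 hy.1 hx.2 hy.2
  · exact hy.2 (hR (m := 0) hx.1 hy.1 hx.2)
  · exact hy.2 (hR (m := 2) hx.1 hy.1 hx.2)

/-- Non-right clones see the whole next class, so they miss any `u` with a neighbour there; right
clones are joined to any `u` without one. Each kind thus leaves at most one clone kind undecided. -/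
theorem pendant_clone_cases (F : H.FiveFrame v) (i : ZMod 5) (k : Fin 5) (m : Fin 3) :
    (∀ u x, H.PendantKind v i k u → H.CloneKind v i m x → H.Adj u x) ∨
    (∀ u x, H.PendantKind v i k u → H.CloneKind v i m x → ¬ H.Adj u x) ∨
    ∀ u x, H.PendantKind v i k u → H.CloneKind v i m x →
      (H.Adj u x → H.After v i k u x) ∧ (¬ H.Adj u x → H.Before v i k u x) := by
  have right : ∀ {u x}, H.IsPendant v (i + 3) u → (∀ y, H.IsClone v (i + 1) y → ¬ H.Adj u y) →
      H.IsRight v i x → H.Adj u x := by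
    rintro u x hu hno ⟨hx, y, hy, hxy⟩
    by_contra hux
    exact hxy (F.adj_of_pendant_clone_clone hu hx hy rfl rfl hux (hno y hy))
  have nonright : ∀ {u x}, (∃ y, H.IsClone v (i + 1) y ∧ H.Adj u y) → H.IsClone v i x →
      ¬ H.IsRight v i x → ¬ H.Adj u x := by
    rintro u x ⟨y, hy, huy⟩ hx hr hux
    exact F.triangleFree hux (adj_of_not_right hx hr hy) huy
  fin_cases k
  · fin_cases m
    · exact Or.inr (Or.inr fun u x _ hx => ⟨fun h => Or.inl ⟨hx, h⟩, fun h => Or.inl ⟨hx, h⟩⟩)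
    · exact Or.inr (Or.inl fun u x hu hx =>
        nonright hu.2.2 hx.1 fun h => F.not_left_of_right h hx)
    · exact Or.inr (Or.inl fun u x hu hx => nonright hu.2.2 hx.1 hx.2.1)
  · fin_cases m
    · exact Or.inl fun u x hu hx => right hu.1 hu.2.1 hx
    · exact Or.inr (Or.inr fun u x _ hx => ⟨fun h => ⟨hx, h⟩, fun h => ⟨hx, h⟩⟩)
    · refine Or.inl fun u z hu hz => ?_
      obtain ⟨hu, -, x, ⟨hx, y, hy, hxy⟩, hux⟩ := hu
      exact F.pendant_adj_of_clone hu hx hz.1 hy (Or.inl ⟨rfl, rfl⟩) hux hxy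
        (adj_of_not_left hz.1 hz.2.2 hy (by clear * -; revert i; decide))
  · fin_cases m
    · exact Or.inl fun u x hu hx => right hu.1 hu.2.1 hx
    · exact Or.inr (Or.inl fun u x hu hx => hu.2.2 x hx)
    · exact Or.inr (Or.inr fun u x _ hx => ⟨fun h => ⟨hx, h⟩, fun h => ⟨hx, h⟩⟩)
  · exact Or.inr (Or.inl fun u x hu hx => hu.2.1 x (cloneKind_isClone hx))
  · exact Or.inr (Or.inl fun u x hu hx => hu.2.1 x (cloneKind_isClone hx))

theorem pendant_clone_succ_cases (F : H.FiveFrame v) (i : ZMod 5) (k : Fin 5) (m : Fin 3) :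
    (∀ u x, H.PendantKind v i k u → H.CloneKind v (i + 1) m x → H.Adj u x) ∨
    (∀ u x, H.PendantKind v i k u → H.CloneKind v (i + 1) m x → ¬ H.Adj u x) ∨
    ∀ u x, H.PendantKind v i k u → H.CloneKind v (i + 1) m x →
      (H.Adj u x → H.Before v i k u x) ∧ (¬ H.Adj u x → H.After v i k u x) := by
  have e : i + 1 + 4 = i := by clear * -; revert i; decide
  have left : ∀ {u y}, H.IsPendant v (i + 3) u → (∀ x, H.IsClone v i x → ¬ H.Adj u x) →
      H.IsLeft v (i + 1) y → H.Adj u y := by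
    rintro u y hu hno ⟨hy, x, hx, hxy⟩
    rw [e] at hx
    by_contra huy
    exact hxy (F.adj_of_pendant_clone_clone hu hx hy rfl rfl (hno x hx) huy).symm
  have nonleft : ∀ {u y}, (∃ x, H.IsClone v i x ∧ H.Adj u x) → H.IsClone v (i + 1) y →
      ¬ H.IsLeft v (i + 1) y → ¬ H.Adj u y := by
    rintro u y ⟨x, hx, hux⟩ hy hl huy
    exact F.triangleFree huy (adj_of_not_left hy hl hx rfl) hux
  fin_cases k
  · fin_cases m
    · exact Or.inr (Or.inl fun u x hu hx => nonleft hu.2.1 hx.1 (F.not_left_of_right hx))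
    · exact Or.inr (Or.inr fun u x _ hx => ⟨fun h => Or.inr ⟨hx, h⟩, fun h => Or.inr ⟨hx, h⟩⟩)
    · exact Or.inr (Or.inl fun u x hu hx => nonleft hu.2.1 hx.1 hx.2.2)
  · exact Or.inr (Or.inl fun u x hu hx => hu.2.1 x (cloneKind_isClone hx))
  · exact Or.inr (Or.inl fun u x hu hx => hu.2.1 x (cloneKind_isClone hx))
  · fin_cases m
    · exact Or.inr (Or.inr fun u x _ hx => ⟨fun h => ⟨hx, h⟩, fun h => ⟨hx, h⟩⟩)
    · exact Or.inl fun u x hu hx => left hu.1 hu.2.1 hx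
    · refine Or.inl fun u z hu hz => ?_
      obtain ⟨hu, -, x, ⟨hx, y, hy, hxy⟩, hux⟩ := hu
      exact F.pendant_adj_of_clone hu hx hz.1 hy (Or.inr ⟨rfl, by ring⟩) hux hxy
        (adj_of_not_right hz.1 hz.2.1 hy)
  · fin_cases m
    · exact Or.inr (Or.inl fun u x hu hx => hu.2.2 x hx)
    · exact Or.inl fun u x hu hx => left hu.1 hu.2.1 hx
    · exact Or.inr (Or.inr fun u x _ hx => ⟨fun h => ⟨hx, h⟩, fun h => ⟨hx, h⟩⟩)

theorem hasOrder [Finite V] (F : H.FiveFrame v) : H.HasOrder 41 := by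
  classical
  have := Fintype.ofFinite V
  obtain ⟨p, h1, h2⟩ := F.exists_clone_order
  choose c hc using F.exists_letter
  -- Clones get even keys. A pendant vertex gets the odd number just above the last clone that must
  -- precede it, or 0 if there is none. Remote vertices are isolated, so their key is immaterial.
  let key : V → ℕ := fun x => match c x with
    | none => 0
    | some (_, .inl _) => 2 * p x + 2
    | some (i, .inr k) => ({y | H.Before v i k x y} : Finset V).sup fun y => 2 * p y + 3
  have hclone : ∀ {x i k}, c x = some (i, .inl k) → H.CloneKind v i k x := by
    intro x i k h
    have := hc x
    rwa [h] at this
  have hpend : ∀ {x i k}, c x = some (i, .inr k) → H.PendantKind v i k x := by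
    intro x i k h
    have := hc x
    rwa [h] at this
  have hrem : ∀ {x}, c x = none → H.IsRemote v x := by
    intro x h
    have := hc x
    rwa [h] at this
  have hkc : ∀ {x i k}, c x = some (i, .inl k) → key x = 2 * p x + 2 := by
    intro x i k h
    simp only [key, h]
  have hkp : ∀ {u i k}, c u = some (i, .inr k) →
      key u = ({y | H.Before v i k u y} : Finset V).sup fun y => 2 * p y + 3 := by
    intro x i k h
    simp only [key, h]
  have hbefore : ∀ {u i k x j m}, c u = some (i, .inr k) → c x = some (j, .inl m) →
      H.Before v i k u x → key x < key u := by
    intro u i k x j m hu hx h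
    rw [hkc hx, hkp hu]
    exact (Nat.lt_succ_self _).trans_le
      (Finset.le_sup (f := fun y => 2 * p y + 3) (by simpa using h))
  have hafter : ∀ {u i k x j m}, c u = some (i, .inr k) → c x = some (j, .inl m) →
      H.After v i k u x → key u < key x := by
    intro u i k x j m hu hx h
    rw [hkc hx, hkp hu]
    refine (Finset.sup_lt_iff (Nat.succ_pos _)).2 fun y hy => ?_
    have := F.lt_of_before_of_after h1 h2 (hpend hu) (by simpa using hy) h
    omega
  have clone_clone : ∀ i k m, H.KeyDetermined key (c · = some (i, .inl k))
      (c · = some (i + 1, .inl m)) := by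
    intro i k m
    by_cases hk : k = 0
    · by_cases hm : m = 1
      · subst hk hm
        refine Or.inr (Or.inr (Or.inl fun x y hx hy => ?_))
        have := h1 i x y (hclone hx) (hclone hy)
        rw [hkc hx, hkc hy]
        exact ⟨fun h => by have := this.1 h; omega, fun h => by have := this.2 h; omega⟩
      · refine Or.inl fun x y hx hy => ?_
        refine (adj_of_not_left (cloneKind_isClone (hclone hy)) ?_
          (cloneKind_isClone (hclone hx)) rfl).symm
        have hy' := hclone hy
        fin_cases m
        · exact F.not_left_of_right hy'
        · exact absurd rfl hm
        · exact hy'.2.2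
    · refine Or.inl fun x y hx hy => ?_
      refine adj_of_not_right (cloneKind_isClone (hclone hx)) ?_ (cloneKind_isClone (hclone hy))
      have hx' := hclone hx
      fin_cases k
      · exact absurd rfl hk
      · exact fun h => F.not_left_of_right h hx'
      · exact hx'.2.1
  have pendant_clone : ∀ i k m, H.KeyDetermined key (c · = some (i, .inr k))
      (c · = some (i, .inl m)) := by
    intro i k m
    rcases F.pendant_clone_cases i k m with h | h | h
    · exact Or.inl fun x y hx hy => h x y (hpend hx) (hclone hy)
    · exact Or.inr (Or.inl fun x y hx hy => h x y (hpend hx) (hclone hy))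
    · refine Or.inr (Or.inr (Or.inl fun x y hx hy => ?_))
      obtain ⟨h3, h4⟩ := h x y (hpend hx) (hclone hy)
      exact ⟨fun h => hafter hx hy (h3 h), fun h => hbefore hx hy (h4 h)⟩
  have pendant_clone_succ : ∀ i k m, H.KeyDetermined key (c · = some (i, .inr k))
      (c · = some (i + 1, .inl m)) := by
    intro i k m
    rcases F.pendant_clone_succ_cases i k m with h | h | h
    · exact Or.inl fun x y hx hy => h x y (hpend hx) (hclone hy)
    · exact Or.inr (Or.inl fun x y hx hy => h x y (hpend hx) (hclone hy))
    · refine Or.inr (Or.inr (Or.inr fun x y hx hy => ?_))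
      obtain ⟨h3, h4⟩ := h x y (hpend hx) (hclone hy)
      exact ⟨fun h => hbefore hx hy (h3 h), fun h => hafter hx hy (h4 h)⟩
  have hmain : ∀ a b, H.KeyDetermined key (c · = a) (c · = b) := by
    have mixed : ∀ i k j m, H.KeyDetermined key (c · = some (i, .inr k))
        (c · = some (j, .inl m)) := by
      intro i k j m
      have : j = i ∨ j = i + 1 ∨ j = i + 3 ∨ (i + 3 = j + 1 ∨ j = i + 3 + 1) := by
        clear * -
        revert i j
        decide
      rcases this with rfl | rfl | rfl | h
      · exact pendant_clone _ k m
      · exact pendant_clone_succ _ k m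
      · exact Or.inl fun x y hx hy => (F.clone_adj_pendant (cloneKind_isClone (hclone hy))
          (pendantKind_isPendant (hpend hx))).symm
      · exact Or.inr (Or.inl fun x y hx hy hxy => F.clone_not_adj_pendant
          (cloneKind_isClone (hclone hy)) (pendantKind_isPendant (hpend hx)) h hxy.symm)
    rintro (_ | ⟨i, k | k⟩) b
    · exact Or.inr (Or.inl fun x y hx _ => F.remote_not_adj (hrem hx))
    · rcases b with _ | ⟨j, m | m⟩
      · exact Or.inr (Or.inl fun x y _ hy h => F.remote_not_adj (hrem hy) h.symm)
      · by_cases hij : j = i + 1 ∨ i = j + 1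
        · rcases hij with rfl | rfl
          · exact clone_clone i k m
          · exact (clone_clone j m k).symm
        · exact Or.inr (Or.inl fun x y hx hy => F.clone_not_adj (cloneKind_isClone (hclone hx))
            (cloneKind_isClone (hclone hy)) hij)
      · exact (mixed j m i k).symm
    · rcases b with _ | ⟨j, m | m⟩
      · exact Or.inr (Or.inl fun x y _ hy h => F.remote_not_adj (hrem hy) h.symm)
      · exact mixed i k j m
      · by_cases hij : j + 3 = i + 3 + 1 ∨ i + 3 = j + 3 + 1
        · refine Or.inl fun x y hx hy => ?_
          have hx' := pendantKind_isPendant (hpend hx)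
          have hy' := pendantKind_isPendant (hpend hy)
          rcases hij with h | h
          · exact F.pendant_adj_pendant hx' hy' h
          · exact (F.pendant_adj_pendant hy' hx' h).symm
        · exact Or.inr (Or.inl fun x y hx hy => F.pendant_not_adj
            (pendantKind_isPendant (hpend hx)) (pendantKind_isPendant (hpend hy)) hij)
  choose T hT using fun a b => (hmain a b).exists_iff
  have := HasOrder.of_letters key c T fun x y _ hk => hT (c x) (c y) x y rfl rfl hk
  -- The alphabet has 1 + 5 · (3 + 5) = 41 letters.
  exact this.mono (by decide)

end FiveFrame

/-! ### Assembling the cases -/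

/-- Graphs without triangle and co-wheel have an order of bounded width. -/
theorem CoWheelFree.hasOrder [Finite V] {H : SimpleGraph V} (hW : H.CoWheelFree)
    (hT : H.TriangleFree) : H.HasOrder 41 := by
  by_cases h5 : H.HasFiveCycle
  · obtain ⟨a, b, c, d, e, h1, h2, h3, h4, h5⟩ := h5
    refine FiveFrame.hasOrder (v := ![a, b, c, d, e]) ⟨hT, hW, fun i => ?_⟩
    fin_cases i
    exacts [h1, h2, h3, h4, h5]
  rcases hW.bipartite_or_cycle hT with h | h | ⟨v, hv⟩
  · obtain ⟨C⟩ := h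
    refine (hW.hasOrder_of_bipartite (col := fun x => C x = 0) fun x y hxy => ?_).mono (by norm_num)
    have := C.valid hxy
    revert this
    generalize C x = i
    generalize C y = j
    revert i j
    decide
  · exact (h5 h).elim
  · exact (hW.hasOrder_of_seven_cycle hT h5 hv).mono (by norm_num)

/-- Graphs without claw pivot-minor have an order of width at most 42. -/
theorem PivotMinorFree.hasOrder [Finite V] {G : SimpleGraph V} (hG : G.PivotMinorFree claw) :
    G.HasOrder 42 := by
  refine HasOrder.of_components fun K => HasOrder.of_compl (CoWheelFree.hasOrder ?_ ?_)
  · intro a b c d e hab hcd nac nad nbc nbd nea neb nec ned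
    have hadj : ∀ {x y}, x ≠ y → ¬ (G.induce K.supp)ᶜ.Adj x y → G.Adj x y := by
      intro x y hne h
      by_contra h'
      exact h ((compl_adj _ _ _).2 ⟨hne, h'⟩)
    -- The hub is `e` and the rim is `a c b d`.
    exact hG.not_wheel_four (hadj (by rintro rfl; exact neb hab) nea)
      (hadj (by rintro rfl; exact ned hcd) nec) (hadj (by rintro rfl; exact nea hab.symm) neb)
      (hadj (by rintro rfl; exact nec hcd.symm) ned) (hadj (by rintro rfl; exact nad hcd) nac)
      (hadj (by rintro rfl; exact nbd hcd) nbc).symm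
      (hadj (by rintro rfl; exact nbc hcd.symm) nbd)
      (hadj (by rintro rfl; exact nac hcd.symm) nad).symm ((compl_adj _ _ _).1 hab).2
      ((compl_adj _ _ _).1 hcd).2 (Subtype.val_injective.ne hab.ne)
      (Subtype.val_injective.ne hcd.ne)
  · intro x y z hxy hyz hxz
    simp only [compl_adj, comap_adj, Embedding.subtype_apply, ne_eq, Subtype.ext_iff] at hxy hyz hxz
    have hr : ∀ y : K.supp, G.Reachable x y := fun y =>
      ConnectedComponent.exact (x.2.trans y.2.symm)
    exact hG.no_independent_triple hxy.1 hxz.1 hyz.1 hxy.2 hxz.2 hyz.2 (hr y) (hr z)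

end SimpleGraph

theorem theorem1p9 {V : Type*} [Fintype V] (G : SimpleGraph V)
    (hG : G.PivotMinorFree SimpleGraph.claw) : G.linearRankWidth ≤ 59 :=
  (hG.hasOrder.mono (by norm_num)).linearRankWidth_le
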